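/- For a meromorphic function $f$ on $\mathbb{C}$ let $T(r,f)$ be its Nevanlinna characteristic and let $$\sigma(f)=\limsup_{r\to\infty}\frac{\log^+ T(r,f)}{\log r}\in[0,\infty]$$ be its order of growth. Let $\eta\in\mathbb{C}$, $\eta\neq 0$, let $\sigma$ be a real number, and let $\Psi$ be an entire function, not identically zero, of order $\sigma(\Psi)=\sigma$. Then the difference equation $$F(z+\eta)=\Psi(z)\,F(z)\qquad(\ast)$$ admits a meromorphic solution $F$ on $\mathbb{C}$ of order exactly $\sigma(F)=\sigma+1$. Moreover, if $\sigma>0$, then every meromorphic solution $F\not\equiv 0$ of $(\ast)$ satisfies $\sigma(F)\ge\sigma+1$, so that $\sigma+1$ is the smallest possible order of a nontrivial meromorphic solution. -/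

import Mathlib

/-- The (Nevanlinna) order of growth `σ(f) = limsup_{r → ∞} log⁺ T(r, f) / log r` of a meromorphic
function `f` on `ℂ`, as an extended real number. Here `T(r, f) = m(r, f) + N(r, f)` is the
Nevanlinna characteristic (the value-distribution functions are those for the value `∞`). -/
noncomputable def growthOrder (f : ℂ → ℂ) : EReal :=
  Filter.limsup
    (fun r : ℝ =>
      ((Real.posLog (ValueDistribution.characteristic f ⊤ r) / Real.log r : ℝ) : EReal))
    Filter.atTop

/-- `F` is a meromorphic function on `ℂ` that solves `F(z + η) = Ψ(z) F(z)`.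
The function `F` is analytic except at isolated poles (it has no removable singularities;
the value stored at a pole is irrelevant), and the equation holds at every `z` such that neither
`z` nor `z + η` is a pole of `F`. This is the identity of meromorphic functions, since the excluded
points form a closed discrete set. -/
structure IsMeromorphicSolution (η : ℂ) (Ψ F : ℂ → ℂ) : Prop where
  meromorphic : MeromorphicNFOn F Set.univ
  equation : ∀ z : ℂ, AnalyticAt ℂ F z → AnalyticAt ℂ F (z + η) → F (z + η) = Ψ z * F z

open Filter Topology ValueDistribution MeromorphicOn Metric MeasureTheory

/-! Both halves rest on the difference analogue of the lemma on the logarithmic derivative: for each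
`0 < δ < 1`, the proximity function of `F(z + η) / F(z)` at `r` is `O(r ^ (-δ) * (T(4r) + T(8r) +
1))` with `T` the characteristic of `F` (`Meromorphic.exists_proximity_shift_div_le`). To prove it,
subtract the Poisson-Jensen formulas at `z` and `z + η` in the disk of radius `4r`. The kernels
differ by `O(1 / r)`. Each zero or pole `a` contributes powers like `|z - a| ^ (-δ)`, whose circle
averages are `O(r ^ (-δ))` uniformly in `a`, and the number of such points is controlled by the
characteristics of `F` and `1 / F` at `8r`.

Lower bound: `Ψ = F(z + η) / F(z)` is entire, so its characteristic is its proximity function. If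
`F` had order below `σ + 1`, taking `δ` near `1` would give `Ψ` order below `σ`
(`growthOrder_lt_of_shift`).

Existence: each zero `a` of `Ψ` is propagated along a progression pointing away from the origin. If
`Re (a / η) ≥ -1/2`, an entire `P₁` vanishes at `a + η, a + 2η, …`; otherwise an entire `P₂`
vanishes at `a, a - η, …`. A progression adds at most one to the exponent of convergence, so
canonical products give `P₁`, `P₂` of order at most `σ + 1`. Then `P₁ / P₂` solves the equation up
to a factor `exp g` with `g` entire. The difference lemma bounds the proximity function of `exp g`
by `r ^ (σ + ε)`, so `g` is a polynomial of degree at most `σ`. A polynomial `H` with `H(z + η) -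
H(z) = g(z)` and degree at most `deg g + 1` exists, and `exp(-H) P₁ / P₂` is a solution of order at
most `σ + 1`.

If `σ > 0`, the lower bound makes the order exact. If `σ = 0` and the order is below one,
multiplying by the `η`-periodic function `exp(2πiz / η)` raises it to exactly one. -/

/-! ### Order of growth and the characteristic -/

theorem eventually_characteristic_le_rpow {f : ℂ → ℂ} {ρ : ℝ} (h : growthOrder f < (ρ : EReal)) :
    ∀ᶠ r : ℝ in atTop, characteristic f ⊤ r ≤ r ^ ρ := by
  filter_upwards [eventually_lt_of_limsup_lt h, eventually_gt_atTop 1] with r hr h1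
  have hlog : 0 < Real.log r := Real.log_pos h1
  have h2 := EReal.coe_lt_coe_iff.1 hr
  rw [div_lt_iff₀ hlog] at h2
  rcases le_or_gt (characteristic f ⊤ r) 0 with hT | hT
  · exact hT.trans (by positivity)
  · have h3 : Real.log (characteristic f ⊤ r) ≤ ρ * Real.log r := by
      refine le_trans ?_ h2.le
      rw [Real.posLog]
      exact le_max_right _ _
    rw [Real.rpow_def_of_pos (by linarith), mul_comm]
    rwa [← Real.log_le_iff_le_exp hT]

theorem growthOrder_nonneg (f : ℂ → ℂ) : 0 ≤ growthOrder f := by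
  refine le_limsup_of_frequently_le (Eventually.frequently ?_)
  filter_upwards [eventually_gt_atTop 1] with r hr
  have := Real.posLog_nonneg (x := characteristic f ⊤ r)
  have hlog : 0 < Real.log r := Real.log_pos hr
  exact_mod_cast (by positivity)

theorem eventually_mul_rpow_le_rpow (C : ℝ) {s t : ℝ} (h : s < t) :
    ∀ᶠ r : ℝ in atTop, C * r ^ s ≤ r ^ t := by
  filter_upwards [(tendsto_rpow_atTop (sub_pos.2 h)).eventually_ge_atTop C,
    eventually_gt_atTop 0] with r hr h0
  calc C * r ^ s ≤ r ^ (t - s) * r ^ s := by gcongr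
    _ = r ^ t := by rw [← Real.rpow_add h0]; ring_nf

theorem growthOrder_le_of_eventually_le {f : ℂ → ℂ} {ρ : ℝ} (hρ : 0 ≤ ρ)
    (h : ∀ s > ρ, ∃ C : ℝ, ∀ᶠ r : ℝ in atTop, characteristic f ⊤ r ≤ C * r ^ s) :
    growthOrder f ≤ (ρ : EReal) := by
  rw [← EReal.le_of_forall_lt_iff_le]
  intro s hs
  replace hs : ρ < s := EReal.coe_lt_coe_iff.1 hs
  obtain ⟨C, hC⟩ := h ((ρ + s) / 2) (by linarith)
  refine limsup_le_of_le (h := ?_)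
  filter_upwards [hC, eventually_mul_rpow_le_rpow C (show (ρ + s) / 2 < s by linarith),
    eventually_gt_atTop 1, characteristic_eventually_nonneg (f := f) (a := ⊤)] with r h1 h2 h3 h4
  have hlog : 0 < Real.log r := Real.log_pos h3
  rw [EReal.coe_le_coe_iff, div_le_iff₀ hlog, ← Real.log_rpow (by linarith)]
  rw [← Real.posLog_eq_log (x := r ^ s)]
  · exact Real.posLog_le_posLog h4 (h1.trans h2)
  · rw [abs_of_nonneg (by positivity)]
    exact Real.one_le_rpow h3.le (by linarith)

theorem growthOrder_congr_codiscrete {f g : ℂ → ℂ} (h : f =ᶠ[codiscrete ℂ] g) :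
    growthOrder f = growthOrder g := by
  refine limsup_congr ?_
  filter_upwards [eventually_ne_atTop 0] with r hr
  rw [characteristic_congr_codiscrete h hr]

theorem logCounting_top_of_differentiable {f : ℂ → ℂ} (hf : Differentiable ℂ f) :
    logCounting f ⊤ = 0 := by
  have h : (divisor f Set.univ)⁻ = 0 := by
    rw [negPart_eq_zero]
    exact AnalyticOnNhd.divisor_nonneg (fun z _ ↦ hf.analyticAt z)
  rw [logCounting_top, h, map_zero]

theorem characteristic_of_differentiable {f : ℂ → ℂ} (hf : Differentiable ℂ f) :
    characteristic f ⊤ = proximity f ⊤ := by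
  rw [characteristic, logCounting_top_of_differentiable hf, add_zero]

theorem characteristic_le_of_norm_le_exp {f : ℂ → ℂ} (hf : Differentiable ℂ f) {r B : ℝ}
    (hr : 0 ≤ r) (hB : 0 ≤ B) (h : ∀ z, ‖z‖ = r → ‖f z‖ ≤ Real.exp B) :
    characteristic f ⊤ r ≤ B := by
  rw [characteristic_of_differentiable hf, proximity_top]
  refine Real.circleAverage_mono_on_of_le_circle ?_ fun z hz ↦ ?_
  · exact MeromorphicOn.circleIntegrable_posLog_norm fun z _ ↦ (hf.analyticAt z).meromorphicAt
  · rw [abs_of_nonneg hr] at hz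
    have h1 := h z (by simpa using hz)
    calc Real.posLog ‖f z‖ ≤ Real.posLog (Real.exp B) := Real.posLog_le_posLog (norm_nonneg _) h1
      _ = B := by
        rw [Real.posLog_eq_log, Real.log_exp]
        rw [Real.abs_exp]; exact Real.one_le_exp hB

theorem exists_characteristic_inv_le {f : ℂ → ℂ} (hf : Meromorphic f) :
    ∃ C : ℝ, 0 ≤ C ∧ ∀ r, characteristic f⁻¹ ⊤ r ≤ characteristic f ⊤ r + C := by
  refine ⟨max |Real.log ‖f 0‖| |Real.log ‖meromorphicTrailingCoeffAt f 0‖|, by positivity,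
    fun r ↦ ?_⟩
  have := (abs_le.1 (characteristic_sub_characteristic_inv_le (R := r) hf)).1
  linarith

theorem proximity_le_characteristic {f : ℂ → ℂ} {r : ℝ} (hr : 1 ≤ r) :
    proximity f ⊤ r ≤ characteristic f ⊤ r := by
  have := logCounting_nonneg (f := f) (e := ⊤) hr
  rw [characteristic, Pi.add_apply]; linarith

theorem logCounting_le_characteristic {f : ℂ → ℂ} {r : ℝ} :
    logCounting f ⊤ r ≤ characteristic f ⊤ r := by
  have : 0 ≤ proximity f ⊤ r := proximity_nonneg (f := f) (a := ⊤) r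
  rw [characteristic, Pi.add_apply]; linarith

/-! ### Circle averages of negative powers of a distance -/

/-- Jordan's inequality `sin θ ≥ 2θ/π` compares with `θ ^ (-δ)` on `(0, π/2]`; reflection and
`π`-periodicity do the rest. -/
theorem intervalIntegrable_abs_sin_rpow_neg {δ : ℝ} (h0 : 0 ≤ δ) (h1 : δ < 1) (a b : ℝ) :
    IntervalIntegrable (fun θ ↦ |Real.sin θ| ^ (-δ)) volume a b := by
  have hpi := Real.pi_pos
  have hper : Function.Periodic (fun θ ↦ |Real.sin θ| ^ (-δ)) Real.pi := fun θ ↦ by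
    simp [Real.sin_add_pi]
  have hhalf : IntervalIntegrable (fun θ ↦ |Real.sin θ| ^ (-δ)) volume 0 (Real.pi / 2) := by
    have hg : IntervalIntegrable (fun θ : ℝ ↦ (2 / Real.pi) ^ (-δ) * θ ^ (-δ)) volume
        0 (Real.pi / 2) :=
      (intervalIntegral.intervalIntegrable_rpow' (by linarith)).const_mul _
    refine hg.mono_fun (Measurable.aestronglyMeasurable (by fun_prop)) ?_
    refine (ae_restrict_mem measurableSet_uIoc).mono fun θ hθ ↦ ?_
    rw [Set.uIoc_of_le (by positivity)] at hθ
    have hθ0 := hθ.1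
    have hs := Real.mul_abs_le_abs_sin (x := θ) (by rw [abs_of_pos hθ0]; exact hθ.2)
    rw [abs_of_pos hθ0] at hs
    beta_reduce
    rw [Real.norm_of_nonneg (by positivity), Real.norm_of_nonneg (by positivity),
      ← Real.mul_rpow (by positivity) hθ0.le]
    exact Real.rpow_le_rpow_of_nonpos (by positivity) hs (by linarith)
  refine hper.intervalIntegrable₀ hpi.ne' ?_ a b
  have h2 : IntervalIntegrable (fun θ ↦ |Real.sin θ| ^ (-δ)) volume (Real.pi / 2) Real.pi := by
    have := (hhalf.comp_sub_left Real.pi).symm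
    simp only [Real.sin_pi_sub, sub_zero] at this
    convert! this using 1; ring
  exact hhalf.trans h2

/-- A point of the circle `|z| = r` has distance at least `r |sin(θ - φ)|` from any point of the
ray with argument `φ`. -/
theorem mul_abs_sin_le_norm_circleMap_sub (a : ℂ) {r : ℝ} (hr : 0 ≤ r) (θ : ℝ) :
    r * |Real.sin (θ - a.arg)| ≤ ‖circleMap 0 r θ - a‖ := by
  have h1 : ‖circleMap 0 r θ - a‖ = ‖(circleMap 0 r θ - a) * Complex.exp (-(a.arg * Complex.I))‖ := by
    rw [norm_mul, ← neg_mul, ← Complex.ofReal_neg, Complex.norm_exp_ofReal_mul_I, mul_one]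
  have h2 : (circleMap 0 r θ - a) * Complex.exp (-(a.arg * Complex.I)) =
      r * Complex.exp ((θ - a.arg : ℝ) * Complex.I) - ‖a‖ := by
    conv_lhs => rw [← Complex.norm_mul_exp_arg_mul_I a]
    simp only [circleMap, zero_add, sub_mul, mul_assoc, ← Complex.exp_add]
    simp [sub_eq_add_neg, add_mul]
  rw [h1, h2]
  refine le_trans (le_of_eq ?_) (Complex.abs_im_le_norm _)
  rw [Complex.sub_im, Complex.ofReal_im, Complex.im_ofReal_mul, Complex.exp_ofReal_mul_I_im,
    sub_zero, abs_mul, abs_of_nonneg hr]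

theorem ae_sin_sub_ne_zero (φ : ℝ) : ∀ᵐ θ : ℝ, Real.sin (θ - φ) ≠ 0 := by
  have h : {θ : ℝ | Real.sin (θ - φ) = 0} ⊆ Set.range (fun n : ℤ ↦ n * Real.pi + φ) := by
    intro θ hθ
    obtain ⟨n, hn⟩ := Real.sin_eq_zero_iff.1 hθ
    exact ⟨n, by simp [hn]⟩
  simp only [ae_iff, not_not]
  exact measure_mono_null h ((Set.countable_range _).measure_zero _)

theorem intervalIntegrable_mul_abs_sin_sub_rpow_neg {δ : ℝ} (h0 : 0 ≤ δ) (h1 : δ < 1) (c φ : ℝ) :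
    IntervalIntegrable (fun θ ↦ c * |Real.sin (θ - φ)| ^ (-δ)) volume 0 (2 * Real.pi) := by
  have h := (intervalIntegrable_abs_sin_rpow_neg h0 h1 (0 - φ) (2 * Real.pi - φ)).comp_sub_right φ
  simp only [sub_add_cancel] at h
  exact h.const_mul _

theorem norm_circleMap_sub_rpow_neg_le {δ : ℝ} (h0 : 0 ≤ δ) (a : ℂ) {r : ℝ} (hr : 0 < r) {θ : ℝ}
    (hθ : Real.sin (θ - a.arg) ≠ 0) :
    ‖circleMap 0 r θ - a‖ ^ (-δ) ≤ r ^ (-δ) * |Real.sin (θ - a.arg)| ^ (-δ) := by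
  rw [← Real.mul_rpow hr.le (by positivity)]
  exact Real.rpow_le_rpow_of_nonpos (by positivity)
    (mul_abs_sin_le_norm_circleMap_sub a hr.le θ) (by linarith)

theorem circleIntegrable_norm_sub_rpow_neg {δ : ℝ} (h0 : 0 ≤ δ) (h1 : δ < 1) (a : ℂ) {r : ℝ}
    (hr : 0 < r) : CircleIntegrable (fun z ↦ ‖z - a‖ ^ (-δ)) 0 r := by
  refine (intervalIntegrable_mul_abs_sin_sub_rpow_neg h0 h1 (r ^ (-δ)) a.arg).mono_fun
    (Measurable.aestronglyMeasurable (by unfold circleMap; fun_prop)) ?_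
  refine (ae_restrict_of_ae (ae_sin_sub_ne_zero a.arg)).mono fun θ hθ ↦ ?_
  beta_reduce
  rw [Real.norm_of_nonneg (by positivity), Real.norm_of_nonneg (by positivity)]
  exact norm_circleMap_sub_rpow_neg_le h0 a hr hθ

/-- The constant does not depend on `a`: projecting off the ray through `a` leaves only a rotated
`|sin| ^ (-δ)`, whose integral over a period is fixed. -/
theorem exists_circleAverage_norm_sub_rpow_neg_le {δ : ℝ} (h0 : 0 ≤ δ) (h1 : δ < 1) :
    ∃ C : ℝ, 0 ≤ C ∧ ∀ (a : ℂ) (r : ℝ), 0 < r →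
      Real.circleAverage (fun z ↦ ‖z - a‖ ^ (-δ)) 0 r ≤ C * r ^ (-δ) := by
  have hpi := Real.pi_pos
  refine ⟨(2 * Real.pi)⁻¹ * ∫ θ in (0 : ℝ)..2 * Real.pi, |Real.sin θ| ^ (-δ), ?_,
    fun a r hr ↦ ?_⟩
  · refine mul_nonneg (by positivity) (intervalIntegral.integral_nonneg (by positivity) ?_)
    intro θ _; positivity
  have hper : Function.Periodic (fun θ ↦ |Real.sin θ| ^ (-δ)) (2 * Real.pi) := fun θ ↦ by simp
  have h2 : ∫ θ in (0 : ℝ)..2 * Real.pi, |Real.sin (θ - a.arg)| ^ (-δ) =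
      ∫ θ in (0 : ℝ)..2 * Real.pi, |Real.sin θ| ^ (-δ) := by
    rw [intervalIntegral.integral_comp_sub_right (fun θ ↦ |Real.sin θ| ^ (-δ))]
    have := hper.intervalIntegral_add_eq (0 - a.arg) 0
    rw [zero_add (2 * Real.pi)] at this
    rw [← this]; congr 1; ring
  rw [Real.circleAverage_def, smul_eq_mul, mul_assoc, mul_comm _ (r ^ (-δ)), ← h2,
    ← intervalIntegral.integral_const_mul (r ^ (-δ))]
  refine mul_le_mul_of_nonneg_left ?_ (by positivity)
  exact intervalIntegral.integral_mono_ae (by positivity)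
    (circleIntegrable_norm_sub_rpow_neg h0 h1 a hr)
    (intervalIntegrable_mul_abs_sin_sub_rpow_neg h0 h1 _ _)
    ((ae_sin_sub_ne_zero a.arg).mono fun θ hθ ↦ norm_circleMap_sub_rpow_neg_le h0 a hr hθ)

/-! ### Identities off a closed discrete set -/

theorem eventually_codiscrete_iff {p : ℂ → Prop} :
    (∀ᶠ z in codiscrete ℂ, p z) ↔ ∀ x, ∀ᶠ z in 𝓝[≠] x, p z := by
  rw [Filter.Eventually, codiscrete, mem_codiscreteWithin_iff_forall_mem_nhdsNE]
  simp [Filter.Eventually]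

theorem eventually_codiscrete_comp_add_right {p : ℂ → Prop} (η : ℂ)
    (h : ∀ᶠ z in codiscrete ℂ, p z) : ∀ᶠ z in codiscrete ℂ, p (z + η) := by
  rw [eventually_codiscrete_iff] at h ⊢
  intro x
  have ht : Tendsto (· + η) (𝓝[≠] x) (𝓝[≠] (x + η)) :=
    (continuous_add_const η).continuousAt.continuousWithinAt.tendsto_nhdsWithin
      fun y hy ↦ by simpa using hy
  exact ht.eventually (h (x + η))

theorem Meromorphic.eventually_codiscrete_analyticAt_ne_zero {F : ℂ → ℂ} (hF : Meromorphic F)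
    (hF0 : ∀ z, meromorphicOrderAt F z ≠ ⊤) :
    ∀ᶠ z in codiscrete ℂ, AnalyticAt ℂ F z ∧ F z ≠ 0 := by
  have h1 : ∀ᶠ z in codiscrete ℂ, AnalyticAt ℂ F z :=
    hF.meromorphicOn (s := Set.univ) |>.analyticAt_mem_codiscreteWithin
  have h2 : ∀ᶠ z in codiscrete ℂ, F z ≠ 0 :=
    MeromorphicOn.eventually_codiscreteWithin_apply_ne_zero (U := Set.univ)
      (hF.meromorphicOn) (fun z _ ↦ hF0 z)
  exact h1.and h2

/-! ### The Poisson-Jensen formula -/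

theorem circleIntegrable_re_herglotzRieszKernel_smul {g : ℂ → ℝ} {R : ℝ} {w : ℂ}
    (hg : CircleIntegrable g 0 R) (hw : w ∈ ball 0 R) :
    CircleIntegrable ((Complex.re ∘ herglotzRieszKernel 0 w) • g) 0 R :=
  hg.continuousOn_smul
    (Complex.continuous_re.comp_continuousOn (continuousOn_herglotzRieszKernel_sphere hw))

/-- The **Poisson-Jensen formula** at a point that is neither a zero nor a pole. -/
theorem Meromorphic.log_norm_eq_circleAverage_sub_finsum {F : ℂ → ℂ} (hF : Meromorphic F)
    (hF0 : ∀ z, meromorphicOrderAt F z ≠ ⊤) {R : ℝ} {w : ℂ} (hw : w ∈ ball 0 R)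
    (hFw : AnalyticAt ℂ F w) (hFw0 : F w ≠ 0) :
    Real.log ‖F w‖ =
      Real.circleAverage ((Complex.re ∘ herglotzRieszKernel 0 w) • (Real.log ‖F ·‖)) 0 R -
      ∑ᶠ a, (divisor F (ball 0 R) a : ℝ) * Real.log ‖Complex.canonicalFactor R a w‖ := by
  have hR : 0 < R := pos_of_mem_ball hw
  obtain ⟨h, D⟩ := MeromorphicOn.exists_ecanonicalDecomp
    (hF.meromorphicOn (s := closedBall 0 R)) (fun u ↦ hF0 u)
  have hS := divisor_sphere_support_finite (f := F) (R := R) (c := 0)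
  have hB := divisor_ball_support_finite (hF.meromorphicOn (s := closedBall 0 R))
  have e1 := D.log_norm_eq (ball_subset_closedBall hw)
    ((hFw.meromorphicNFAt).meromorphicOrderAt_eq_zero_iff.2 hFw0) hR
  rw [hFw.meromorphicTrailingCoeffAt_of_ne_zero hFw0] at e1
  set S := hS.toFinset with hSdef
  have hsum (z : ℂ) : ∑ᶠ i, (divisor F (sphere 0 R) i : ℝ) * Real.log ‖z - i‖ =
      ∑ i ∈ S, (divisor F (sphere 0 R) i : ℝ) * Real.log ‖z - i‖ := by
    refine finsum_eq_sum_of_support_subset _ fun i hi ↦ ?_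
    simp only [Function.mem_support, ne_eq, mul_eq_zero, not_or, Int.cast_eq_zero] at hi
    simpa [S] using hi.1
  have hSsphere : ∀ i ∈ S, i ∈ sphere (0 : ℂ) R := fun i hi ↦
    (divisor F (sphere 0 R)).supportWithinDomain (by simpa [S] using hi)
  -- Canonical factors are unimodular on the circle, so there `log ‖F‖` comes only from the
  -- zero-free part `h` and from the zeros and poles on the circle itself. The Poisson integral
  -- reproduces both kinds of term at `w`.
  let u : ℂ → ℝ := (Real.log ‖h ·‖) +
    ∑ i ∈ S, (divisor F (sphere 0 R) i : ℝ) • (Real.log ‖· - i‖)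
  have hucongr : (Real.log ‖F ·‖) =ᶠ[codiscreteWithin (sphere 0 |R|)] u := by
    have h1 := D.eventuallyEq.filter_mono
      (codiscreteWithin_mono (sphere_subset_closedBall : sphere (0 : ℂ) R ⊆ closedBall 0 R))
    rw [abs_of_pos hR]
    have h2 : ∀ᶠ z in codiscreteWithin (sphere (0 : ℂ) R), z ∉ S := by
      have := (S.finite_toSet.compl_mem_codiscrete)
      exact Filter.codiscreteWithin_mono (Set.subset_univ _) this
    filter_upwards [h1, h2, self_mem_codiscreteWithin (sphere (0 : ℂ) R)] with z hz hzS hzs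
    have p1 : ‖(∏ᶠ u, (Complex.canonicalFactor R u) ^ (-divisor F (ball 0 R) u)) z‖ = 1 := by
      rw [finprod_eq_prod_of_mulSupport_subset (s := hB.toFinset), Finset.prod_apply, norm_prod]
      · refine Finset.prod_eq_one fun a ha ↦ ?_
        have ha' : a ∈ ball (0 : ℂ) R :=
          (divisor F (ball 0 R)).supportWithinDomain (by simpa using ha)
        rw [Pi.pow_apply, norm_zpow, Complex.norm_canonicalFactor_eval_circle_eq_one ha' hzs,
          one_zpow]
      · intro a ha
        simp only [Set.Finite.coe_toFinset, Function.mem_support]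
        intro h0
        exact ha (by simp [h0])
    have p2 : (∏ᶠ v, (· - v) ^ (divisor F (sphere 0 R)) v : ℂ → ℂ) z =
        ∏ v ∈ S, (z - v) ^ (divisor F (sphere 0 R) v) := by
      rw [finprod_eq_prod_of_mulSupport_subset (s := S), Finset.prod_apply]
      · simp
      · intro a ha
        simp only [S, Set.Finite.coe_toFinset, Function.mem_support]
        intro h0
        exact ha (by simp [h0])
    have hne : ∀ v ∈ S, z - v ≠ 0 := fun v hv h0 ↦ hzS (by rwa [sub_eq_zero.1 h0])
    have hhz : h z ≠ 0 := D.ne_zero z (sphere_subset_closedBall hzs)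
    rw [hz]
    simp only [Pi.smul_apply', Pi.mul_apply, smul_eq_mul, norm_mul, p1, p2, one_mul, norm_prod,
      norm_zpow]
    rw [Real.log_mul (Finset.prod_ne_zero_iff.2 fun v hv ↦ zpow_ne_zero _
      (norm_ne_zero_iff.2 (hne v hv))) (norm_ne_zero_iff.2 hhz),
      Real.log_prod (fun v hv ↦ zpow_ne_zero _ (norm_ne_zero_iff.2 (hne v hv)))]
    simp [u, Real.log_zpow, add_comm]
  have hhint : CircleIntegrable (Real.log ‖h ·‖) 0 R := by
    refine MeromorphicOn.circleIntegrable_log_norm fun z hz ↦ ?_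
    rw [abs_of_pos hR] at hz
    exact (D.analyticOnNhd z (sphere_subset_closedBall hz)).meromorphicAt
  have hlint (i : ℂ) : CircleIntegrable (Real.log ‖· - i‖) 0 R :=
    MeromorphicOn.circleIntegrable_log_norm (f := (· - i)) fun z _ ↦ by fun_prop
  have e2 : Real.circleAverage ((Complex.re ∘ herglotzRieszKernel 0 w) • (Real.log ‖F ·‖)) 0 R =
      Real.log ‖h w‖ + ∑ i ∈ S, (divisor F (sphere 0 R) i : ℝ) * Real.log ‖w - i‖ := by
    rw [Real.circleAverage_congr_codiscreteWithin
      (f₂ := (Complex.re ∘ herglotzRieszKernel 0 w) • u) _ hR.ne']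
    · have hu : (Complex.re ∘ herglotzRieszKernel 0 w) • u =
          (Complex.re ∘ herglotzRieszKernel 0 w) • (Real.log ‖h ·‖) +
          ∑ i ∈ S, (divisor F (sphere 0 R) i : ℝ) •
            ((Complex.re ∘ herglotzRieszKernel 0 w) • (Real.log ‖· - i‖)) := by
        simp only [u, smul_add, Finset.smul_sum]
        congr 1
        refine Finset.sum_congr rfl fun i _ ↦ ?_
        exact smul_comm _ _ _
      rw [hu, Real.circleAverage_add (circleIntegrable_re_herglotzRieszKernel_smul hhint hw),
        Real.circleAverage_sum]
      · congr 1
        · exact InnerProductSpace.HarmonicOnNhd.circleAverage_re_herglotzRieszKernel_smul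
            (fun z hz ↦ (D.analyticOnNhd z hz).harmonicAt_log_norm (D.ne_zero z hz)) hw
        · refine Finset.sum_congr rfl fun i hi ↦ ?_
          rw [Real.circleAverage_smul, smul_eq_mul]
          congr 1
          exact circleAverage_re_herglotzRieszKernel_mul_log (hSsphere i hi) hw
      · exact fun i _ ↦ (circleIntegrable_re_herglotzRieszKernel_smul (hlint i) hw).const_smul
      · exact CircleIntegrable.sum _ fun i _ ↦
          (circleIntegrable_re_herglotzRieszKernel_smul (hlint i) hw).const_smul
    · filter_upwards [hucongr] with z hz
      simp only [Pi.smul_apply', hz]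
  rw [e2, e1, hsum]
  ring

/-! ### The difference analogue of the lemma on the logarithmic derivative -/

/-- Subadditivity of `x ^ δ` followed by `log y ≤ y - 1`. This trades a logarithm for a power whose
singularity is integrable on circles when `δ < 1`. -/
theorem log_one_add_le_rpow_div {δ x : ℝ} (h0 : 0 < δ) (h1 : δ ≤ 1) (hx : 0 ≤ x) :
    Real.log (1 + x) ≤ x ^ δ / δ := by
  rw [le_div_iff₀ h0, mul_comm, ← Real.log_rpow (by linarith)]
  have h2 : (1 + x) ^ δ ≤ 1 + x ^ δ := by
    simpa using Real.rpow_add_le_add_rpow zero_le_one hx h0.le h1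
  calc Real.log ((1 + x) ^ δ) ≤ Real.log (1 + x ^ δ) := Real.log_le_log (by positivity) h2
    _ ≤ x ^ δ := by
      have := Real.log_le_sub_one_of_pos (show 0 < 1 + x ^ δ by positivity)
      linarith

theorem log_norm_sub_log_norm_le {δ : ℝ} (h0 : 0 < δ) (h1 : δ ≤ 1) {x y : ℂ} (hx : x ≠ 0)
    (hy : y ≠ 0) :
    Real.log ‖x‖ - Real.log ‖y‖ ≤ ‖x - y‖ ^ δ / δ * ‖y‖ ^ (-δ) := by
  have hx' := norm_pos_iff.2 hx
  have hy' := norm_pos_iff.2 hy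
  rw [← Real.log_div hx'.ne' hy'.ne']
  have h2 : ‖x‖ / ‖y‖ ≤ 1 + ‖x - y‖ / ‖y‖ := by
    rw [div_le_iff₀ hy', add_mul, div_mul_cancel₀ _ hy'.ne', one_mul]
    have := norm_add_le y (x - y)
    simpa using this
  calc Real.log (‖x‖ / ‖y‖) ≤ Real.log (1 + ‖x - y‖ / ‖y‖) := Real.log_le_log (by positivity) h2
    _ ≤ (‖x - y‖ / ‖y‖) ^ δ / δ := log_one_add_le_rpow_div h0 h1 (by positivity)
    _ = _ := by
      rw [Real.div_rpow (norm_nonneg _) hy'.le, Real.rpow_neg hy'.le]; ring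

theorem abs_log_norm_sub_log_norm_le {δ : ℝ} (h0 : 0 < δ) (h1 : δ ≤ 1) {x y : ℂ} (hx : x ≠ 0)
    (hy : y ≠ 0) :
    |Real.log ‖x‖ - Real.log ‖y‖| ≤ ‖x - y‖ ^ δ / δ * (‖x‖ ^ (-δ) + ‖y‖ ^ (-δ)) := by
  have a1 := log_norm_sub_log_norm_le h0 h1 hx hy
  have a2 := log_norm_sub_log_norm_le h0 h1 hy hx
  rw [norm_sub_rev y x] at a2
  have p1 : 0 ≤ ‖x - y‖ ^ δ / δ * ‖x‖ ^ (-δ) := by positivity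
  have p2 : 0 ≤ ‖x - y‖ ^ δ / δ * ‖y‖ ^ (-δ) := by positivity
  rw [abs_le, mul_add]
  constructor <;> linarith

/-- The difference of kernels is `2ζ(w' - w) / ((ζ - w')(ζ - w))`, and both factors of the
denominator have modulus at least `4r - 2r`. -/
theorem abs_re_herglotzRieszKernel_sub_le {r : ℝ} (hr : 0 < r) {w w' ζ : ℂ} (hw : ‖w‖ ≤ 2 * r)
    (hw' : ‖w'‖ ≤ 2 * r) (hζ : ‖ζ‖ = 4 * r) :
    |(herglotzRieszKernel 0 w' ζ).re - (herglotzRieszKernel 0 w ζ).re| ≤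
      2 * ‖w' - w‖ / r := by
  have d (v : ℂ) (hv : ‖v‖ ≤ 2 * r) : 2 * r ≤ ‖ζ - v‖ := by
    have := norm_sub_norm_le ζ v; linarith
  have n1 : ζ - w ≠ 0 := norm_pos_iff.1 (by linarith [d w hw])
  have n2 : ζ - w' ≠ 0 := norm_pos_iff.1 (by linarith [d w' hw'])
  rw [← Complex.sub_re]
  refine (Complex.abs_re_le_norm _).trans ?_
  have : herglotzRieszKernel 0 w' ζ - herglotzRieszKernel 0 w ζ =
      2 * ζ * (w' - w) / ((ζ - w') * (ζ - w)) := by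
    simp only [herglotzRieszKernel_def, sub_zero]
    field_simp; ring
  rw [this, norm_div, norm_mul, norm_mul, norm_mul, hζ, Complex.norm_ofNat,
    div_le_div_iff₀ (by positivity) hr]
  have := mul_le_mul (d w' hw') (d w hw) (by positivity) (norm_nonneg _)
  calc 2 * (4 * r) * ‖w' - w‖ * r = 2 * ‖w' - w‖ * ((2 * r) * (2 * r)) := by ring
    _ ≤ _ := by gcongr

/-- The logarithm splits into that of `v - a`, which gives the two singular powers, and that of the
numerator `(4r)² - conj(a) v`, which stays above `8r²` and gives only the term `2 * r ^ (-δ)`. -/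
theorem abs_log_norm_canonicalFactor_sub_le {δ : ℝ} (h0 : 0 < δ) (h1 : δ ≤ 1) {r : ℝ} (hr : 0 < r)
    {w w' a : ℂ} (hw : ‖w‖ ≤ 2 * r) (hw' : ‖w'‖ ≤ 2 * r) (ha : ‖a‖ < 4 * r)
    (hwa : w ≠ a) (hwa' : w' ≠ a) :
    |Real.log ‖Complex.canonicalFactor (4 * r) a w'‖ -
      Real.log ‖Complex.canonicalFactor (4 * r) a w‖| ≤
      ‖w' - w‖ ^ δ / δ * (‖w - a‖ ^ (-δ) + ‖w' - a‖ ^ (-δ) + 2 * r ^ (-δ)) := by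
  have hlow (v : ℂ) (hv : ‖v‖ ≤ 2 * r) :
      8 * r ^ 2 ≤ ‖(((4 * r : ℝ) : ℂ)) ^ 2 - (starRingEnd ℂ a) * v‖ := by
    have h3 := norm_sub_norm_le ((((4 * r : ℝ) : ℂ)) ^ 2) ((starRingEnd ℂ a) * v)
    rw [norm_mul, RCLike.norm_conj, norm_pow, Complex.norm_real,
      Real.norm_of_nonneg (by positivity)] at h3
    have h4 : ‖a‖ * ‖v‖ ≤ (4 * r) * (2 * r) := by gcongr
    nlinarith
  have hne (v : ℂ) (hv : ‖v‖ ≤ 2 * r) : (((4 * r : ℝ) : ℂ)) ^ 2 - (starRingEnd ℂ a) * v ≠ 0 :=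
    norm_pos_iff.1 (lt_of_lt_of_le (by positivity) (hlow v hv))
  have hlog (v : ℂ) (hv : ‖v‖ ≤ 2 * r) (hva : v ≠ a) :
      Real.log ‖Complex.canonicalFactor (4 * r) a v‖ =
      Real.log ‖(((4 * r : ℝ) : ℂ)) ^ 2 - (starRingEnd ℂ a) * v‖ - Real.log ‖v - a‖ -
        Real.log (4 * r) := by
    rw [Complex.canonicalFactor_apply, norm_div, norm_mul, Complex.norm_real,
      Real.norm_of_nonneg (by positivity), Real.log_div (norm_ne_zero_iff.2 (hne v hv)),
      Real.log_mul (by positivity) (norm_ne_zero_iff.2 (sub_ne_zero.2 hva))]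
    · ring
    · exact mul_ne_zero (by positivity) (norm_ne_zero_iff.2 (sub_ne_zero.2 hva))
  rw [hlog w hw hwa, hlog w' hw' hwa']
  have b1 := abs_log_norm_sub_log_norm_le h0 h1 (hne w' hw') (hne w hw)
  have b2 := abs_log_norm_sub_log_norm_le h0 h1 (sub_ne_zero.2 hwa') (sub_ne_zero.2 hwa)
  have e1 : w' - a - (w - a) = w' - w := by ring
  rw [e1] at b2
  have e2 : ‖((((4 * r : ℝ) : ℂ)) ^ 2 - (starRingEnd ℂ a) * w') -
      ((((4 * r : ℝ) : ℂ)) ^ 2 - (starRingEnd ℂ a) * w)‖ ≤ ‖w' - w‖ * (4 * r) := by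
    have : ((((4 * r : ℝ) : ℂ)) ^ 2 - (starRingEnd ℂ a) * w') -
      ((((4 * r : ℝ) : ℂ)) ^ 2 - (starRingEnd ℂ a) * w) = - ((w' - w) * (starRingEnd ℂ a)) := by
      ring
    rw [this, norm_neg, norm_mul, RCLike.norm_conj]
    gcongr
  have e3 (v : ℂ) (hv : ‖v‖ ≤ 2 * r) :
      ‖(((4 * r : ℝ) : ℂ)) ^ 2 - (starRingEnd ℂ a) * v‖ ^ (-δ) ≤ (8 * r ^ 2) ^ (-δ) :=
    Real.rpow_le_rpow_of_nonpos (by positivity) (hlow v hv) (by linarith)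
  have e4 : (‖w' - w‖ * (4 * r)) ^ δ * (8 * r ^ 2) ^ (-δ) ≤ ‖w' - w‖ ^ δ * r ^ (-δ) := by
    rw [Real.rpow_neg (by positivity), Real.rpow_neg (by positivity), ← div_eq_mul_inv,
      ← div_eq_mul_inv, ← Real.div_rpow (by positivity) (by positivity),
      ← Real.div_rpow (by positivity) (by positivity)]
    refine Real.rpow_le_rpow (by positivity) ?_ h0.le
    rw [div_le_div_iff₀ (by positivity) hr]
    have : 0 ≤ ‖w' - w‖ * r ^ 2 := by positivity
    nlinarith
  have b3 := calc
    _ ≤ _ := b1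
    _ ≤ (‖w' - w‖ * (4 * r)) ^ δ / δ * ((8 * r ^ 2) ^ (-δ) + (8 * r ^ 2) ^ (-δ)) := by
      refine mul_le_mul ?_ (add_le_add (e3 w' hw') (e3 w hw)) (by positivity) (by positivity)
      gcongr
    _ = 2 / δ * ((‖w' - w‖ * (4 * r)) ^ δ * (8 * r ^ 2) ^ (-δ)) := by ring
    _ ≤ 2 / δ * (‖w' - w‖ ^ δ * r ^ (-δ)) := by gcongr
    _ = ‖w' - w‖ ^ δ / δ * (2 * r ^ (-δ)) := by ring
  rw [abs_le] at b2 b3 ⊢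
  have e5 : ‖w' - w‖ ^ δ / δ * (‖w - a‖ ^ (-δ) + ‖w' - a‖ ^ (-δ) + 2 * r ^ (-δ)) =
    ‖w' - w‖ ^ δ / δ * (‖w' - a‖ ^ (-δ) + ‖w - a‖ ^ (-δ)) +
      ‖w' - w‖ ^ δ / δ * (2 * r ^ (-δ)) := by ring
  rw [e5]
  constructor <;> linarith [b2.1, b2.2, b3.1, b3.2]

/-- The number of points of an effective divisor in the disk `|z| ≤ ρ` is controlled by the
logarithmic counting function at the radius `2ρ`. -/
theorem sum_mul_log_two_le_logCounting {D : Function.locallyFinsupp ℂ ℤ} (hD : 0 ≤ D) {ρ : ℝ}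
    (hρ : 1 ≤ ρ) (S : Finset ℂ) (hS : ∀ a ∈ S, ‖a‖ ≤ ρ) :
    (∑ a ∈ S, (D a : ℝ)) * Real.log 2 ≤ Function.locallyFinsuppWithin.logCounting D (2 * ρ) := by
  have hl2 : 0 < Real.log 2 := Real.log_pos one_lt_two
  have hDa (a : ℂ) : (0 : ℝ) ≤ D a := by exact_mod_cast hD a
  set E := Function.locallyFinsuppWithin.toClosedBall (2 * ρ) D with hE
  have hEfin : E.support.Finite := E.finiteSupport (isCompact_closedBall 0 |2 * ρ|)
  have hEeval {z : ℂ} (hz : ‖z‖ ≤ 2 * ρ) : E z = D z :=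
    Function.locallyFinsuppWithin.toClosedBall_eval_within D
      (by simpa [abs_of_pos (show 0 < 2 * ρ by linarith)] using hz)
  have hEnn (z : ℂ) : (0 : ℝ) ≤ E z := by
    by_cases hz : ‖z‖ ≤ 2 * ρ
    · rw [hEeval hz]; exact hDa z
    · have : E z = 0 := Function.locallyFinsuppWithin.apply_eq_zero_of_notMem _
        (by simpa [abs_of_pos (show 0 < 2 * ρ by linarith)] using hz)
      simp [this]
  have hterm (z : ℂ) : 0 ≤ (E z : ℝ) * Real.log (2 * ρ * ‖z‖⁻¹) := by
    by_cases hz : ‖z‖ ≤ 2 * ρ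
    · by_cases hz0 : z = 0
      · simp [hz0]
      refine mul_nonneg (hEnn z) (Real.log_nonneg ?_)
      rw [← div_eq_mul_inv, le_div_iff₀ (norm_pos_iff.2 hz0)]; linarith
    · have : E z = 0 := Function.locallyFinsuppWithin.apply_eq_zero_of_notMem _
        (by simpa [abs_of_pos (show 0 < 2 * ρ by linarith)] using hz)
      simp [this]
  have hcount : Function.locallyFinsuppWithin.logCounting D (2 * ρ) =
      ∑ a ∈ S ∪ hEfin.toFinset, (E a : ℝ) * Real.log (2 * ρ * ‖a‖⁻¹) +
        (D 0 : ℝ) * Real.log (2 * ρ) := by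
    simp only [Function.locallyFinsuppWithin.logCounting, AddMonoidHom.coe_mk, ZeroHom.coe_mk]
    congr 1
    refine finsum_eq_sum_of_support_subset _ fun z hz ↦ ?_
    simp only [Function.mem_support, ne_eq, mul_eq_zero, not_or, Int.cast_eq_zero] at hz
    have hEz : E z ≠ 0 := hz.1
    simp [hEz]
  rw [hcount]
  have hlog2ρ : Real.log 2 ≤ Real.log (2 * ρ) := Real.log_le_log (by norm_num) (by linarith)
  -- A point `a ≠ 0` has weight `log (2ρ / ‖a‖) ≥ log 2`. At `a = 0` that weight is `log 0 = 0` by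
  -- convention, so the origin is counted by the separate term `D 0 * log (2ρ)`.
  have h1 : ∑ a ∈ S, (D a : ℝ) * Real.log 2 ≤
      ∑ a ∈ S, ((E a : ℝ) * Real.log (2 * ρ * ‖a‖⁻¹) +
        if a = 0 then (D 0 : ℝ) * Real.log (2 * ρ) else 0) := by
    refine Finset.sum_le_sum fun a ha ↦ ?_
    by_cases ha0 : a = 0
    · subst ha0
      simp only [norm_zero, inv_zero, mul_zero, Real.log_zero, if_true, zero_add]
      exact mul_le_mul_of_nonneg_left hlog2ρ (hDa 0)
    · rw [if_neg ha0, add_zero, hEeval (by linarith [hS a ha])]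
      refine mul_le_mul_of_nonneg_left (Real.log_le_log (by norm_num) ?_) (hDa a)
      rw [← div_eq_mul_inv, le_div_iff₀ (norm_pos_iff.2 ha0)]
      linarith [hS a ha]
  rw [Finset.sum_mul]
  refine h1.trans ?_
  rw [Finset.sum_add_distrib]
  refine add_le_add (Finset.sum_le_sum_of_subset_of_nonneg Finset.subset_union_left
    fun z _ _ ↦ hterm z) ?_
  rw [Finset.sum_ite_eq' S (0 : ℂ)]
  split_ifs
  · exact le_rfl
  · exact mul_nonneg (hDa 0) (by linarith)

/-- A pointwise form of the difference analogue of the lemma on the logarithmic derivative. -/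
theorem Meromorphic.abs_log_norm_sub_log_norm_le {F : ℂ → ℂ} (hF : Meromorphic F)
    (hF0 : ∀ z, meromorphicOrderAt F z ≠ ⊤) {δ : ℝ} (h0 : 0 < δ) (h1 : δ ≤ 1) {r : ℝ} (hr : 0 < r)
    {w w' : ℂ} (hw : ‖w‖ ≤ 2 * r) (hw' : ‖w'‖ ≤ 2 * r)
    (hFw : AnalyticAt ℂ F w) (hFw0 : F w ≠ 0) (hFw' : AnalyticAt ℂ F w') (hFw0' : F w' ≠ 0)
    {S : Finset ℂ} (hS : (divisor F (ball 0 (4 * r))).support = S) :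
    |Real.log ‖F w'‖ - Real.log ‖F w‖| ≤
      2 * ‖w' - w‖ / r * Real.circleAverage (fun z ↦ |Real.log ‖F z‖|) 0 (4 * r) +
      ∑ a ∈ S, |(divisor F (ball 0 (4 * r)) a : ℝ)| *
        (‖w' - w‖ ^ δ / δ * (‖w - a‖ ^ (-δ) + ‖w' - a‖ ^ (-δ) + 2 * r ^ (-δ))) := by
  have hR : 0 < 4 * r := by positivity
  have hwB : w ∈ ball (0 : ℂ) (4 * r) := by rw [mem_ball_zero_iff]; linarith
  have hwB' : w' ∈ ball (0 : ℂ) (4 * r) := by rw [mem_ball_zero_iff]; linarith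
  have hord {v : ℂ} (hv : AnalyticAt ℂ F v) (hv0 : F v ≠ 0) {a : ℂ} (ha : a ∈ S) : v ≠ a := by
    rintro rfl
    have ha' : v ∈ (divisor F (ball 0 (4 * r))).support := by rw [hS]; exact ha
    refine ha' ?_
    have hvB := (divisor F (ball 0 (4 * r))).supportWithinDomain ha'
    rw [divisor_apply (hF.meromorphicOn) hvB,
      hv.meromorphicNFAt.meromorphicOrderAt_eq_zero_iff.2 hv0]
    rfl
  have hlint : CircleIntegrable (Real.log ‖F ·‖) 0 (4 * r) :=
    MeromorphicOn.circleIntegrable_log_norm hF.meromorphicOn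
  have hsum (v : ℂ) : ∑ᶠ a, (divisor F (ball 0 (4 * r)) a : ℝ) *
      Real.log ‖Complex.canonicalFactor (4 * r) a v‖ = ∑ a ∈ S,
      (divisor F (ball 0 (4 * r)) a : ℝ) * Real.log ‖Complex.canonicalFactor (4 * r) a v‖ := by
    refine finsum_eq_sum_of_support_subset _ fun i hi ↦ ?_
    simp only [Function.mem_support, ne_eq, mul_eq_zero, not_or, Int.cast_eq_zero] at hi
    rw [← hS]; exact hi.1
  rw [hF.log_norm_eq_circleAverage_sub_finsum hF0 hwB hFw hFw0,
    hF.log_norm_eq_circleAverage_sub_finsum hF0 hwB' hFw' hFw0', hsum, hsum]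
  have e1 : Real.circleAverage ((Complex.re ∘ herglotzRieszKernel 0 w') • (Real.log ‖F ·‖)) 0
        (4 * r) -
      Real.circleAverage ((Complex.re ∘ herglotzRieszKernel 0 w) • (Real.log ‖F ·‖)) 0 (4 * r) =
      Real.circleAverage ((Complex.re ∘ herglotzRieszKernel 0 w') • (Real.log ‖F ·‖) -
        (Complex.re ∘ herglotzRieszKernel 0 w) • (Real.log ‖F ·‖)) 0 (4 * r) :=
    (Real.circleAverage_sub (circleIntegrable_re_herglotzRieszKernel_smul hlint hwB')
      (circleIntegrable_re_herglotzRieszKernel_smul hlint hwB)).symm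
  have b1 : |Real.circleAverage ((Complex.re ∘ herglotzRieszKernel 0 w') • (Real.log ‖F ·‖)) 0
        (4 * r) -
      Real.circleAverage ((Complex.re ∘ herglotzRieszKernel 0 w) • (Real.log ‖F ·‖)) 0 (4 * r)| ≤
      2 * ‖w' - w‖ / r * Real.circleAverage (fun z ↦ |Real.log ‖F z‖|) 0 (4 * r) := by
    rw [e1, ← smul_eq_mul (2 * ‖w' - w‖ / r), ← Real.circleAverage_fun_smul]
    refine Real.abs_circleAverage_le_circleAverage_abs.trans (Real.circleAverage_mono ?_ ?_ ?_)
    · exact ((circleIntegrable_re_herglotzRieszKernel_smul hlint hwB').sub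
        (circleIntegrable_re_herglotzRieszKernel_smul hlint hwB)).abs
    · exact hlint.abs.const_smul
    · intro ζ hζ
      rw [abs_of_pos hR, mem_sphere_zero_iff_norm] at hζ
      simp only [Pi.abs_apply, Pi.sub_apply, Pi.mul_apply, Function.comp_apply, smul_eq_mul]
      rw [← sub_mul, abs_mul]
      gcongr
      exact abs_re_herglotzRieszKernel_sub_le hr hw hw' hζ
  have b2 : |∑ a ∈ S, (divisor F (ball 0 (4 * r)) a : ℝ) *
        Real.log ‖Complex.canonicalFactor (4 * r) a w'‖ -
      ∑ a ∈ S, (divisor F (ball 0 (4 * r)) a : ℝ) *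
        Real.log ‖Complex.canonicalFactor (4 * r) a w‖| ≤
      ∑ a ∈ S, |(divisor F (ball 0 (4 * r)) a : ℝ)| *
        (‖w' - w‖ ^ δ / δ * (‖w - a‖ ^ (-δ) + ‖w' - a‖ ^ (-δ) + 2 * r ^ (-δ))) := by
    rw [← Finset.sum_sub_distrib]
    refine (Finset.abs_sum_le_sum_abs _ _).trans (Finset.sum_le_sum fun a ha ↦ ?_)
    rw [← mul_sub, abs_mul]
    gcongr
    have haB : a ∈ ball (0 : ℂ) (4 * r) :=
      (divisor F (ball 0 (4 * r))).supportWithinDomain (by rw [hS]; exact ha)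
    exact abs_log_norm_canonicalFactor_sub_le h0 h1 hr hw hw' (by simpa using haB)
      (hord hFw hFw0 ha) (hord hFw' hFw0' ha)
  rw [abs_le] at b1 b2 ⊢
  constructor <;> linarith [b1.1, b1.2, b2.1, b2.2]

/-- Pointwise, `|log x| = log⁺ x + log⁺ (1/x)`. -/
theorem circleAverage_abs_log_norm {F : ℂ → ℂ} (hF : Meromorphic F) (R : ℝ) :
    Real.circleAverage (fun z ↦ |Real.log ‖F z‖|) 0 R =
      proximity F ⊤ R + proximity F⁻¹ ⊤ R := by
  rw [proximity_top, proximity_top, ← Real.circleAverage_fun_add]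
  · congr 1; ext z
    rw [Pi.inv_apply, norm_inv, ← Real.half_mul_log_add_log_abs, ← Real.half_mul_log_add_log_abs,
      Real.log_inv, abs_neg]
    ring
  · exact MeromorphicOn.circleIntegrable_posLog_norm hF.meromorphicOn
  · exact MeromorphicOn.circleIntegrable_posLog_norm hF.inv.meromorphicOn

/-- Poles are counted by the characteristic of `F`, zeros by that of `F⁻¹`. -/
theorem Meromorphic.sum_abs_divisor_mul_log_two_le {F : ℂ → ℂ} (hF : Meromorphic F)
    {ρ : ℝ} (hρ : 1 ≤ ρ) {S : Finset ℂ} (hS : ∀ a ∈ S, a ∈ ball (0 : ℂ) ρ) :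
    (∑ a ∈ S, |(divisor F (ball 0 ρ) a : ℝ)|) * Real.log 2 ≤
      characteristic F ⊤ (2 * ρ) + characteristic F⁻¹ ⊤ (2 * ρ) := by
  have hb := fun a ha ↦ (mem_ball_zero_iff.1 (hS a ha)).le
  have h1 := sum_mul_log_two_le_logCounting (posPart_nonneg (divisor F Set.univ)) hρ S hb
  have h2 := sum_mul_log_two_le_logCounting (negPart_nonneg (divisor F Set.univ)) hρ S hb
  have e1 : Function.locallyFinsuppWithin.logCounting (divisor F Set.univ)⁻ (2 * ρ) ≤
      characteristic F ⊤ (2 * ρ) := by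
    rw [← logCounting_top]; exact logCounting_le_characteristic
  have e2 : Function.locallyFinsuppWithin.logCounting (divisor F Set.univ)⁺ (2 * ρ) ≤
      characteristic F⁻¹ ⊤ (2 * ρ) := by
    rw [← logCounting_zero, ← logCounting_inv]; exact logCounting_le_characteristic
  have e3 : ∑ a ∈ S, |(divisor F (ball 0 ρ) a : ℝ)| =
      ∑ a ∈ S, (((divisor F Set.univ)⁺ a : ℤ) : ℝ) +
        ∑ a ∈ S, (((divisor F Set.univ)⁻ a : ℤ) : ℝ) := by
    rw [← Finset.sum_add_distrib]
    refine Finset.sum_congr rfl fun a ha ↦ ?_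
    rw [divisor_apply hF.meromorphicOn (hS a ha), Function.locallyFinsuppWithin.posPart_apply,
      Function.locallyFinsuppWithin.negPart_apply, divisor_apply hF.meromorphicOn (Set.mem_univ a)]
    rw [← Int.cast_add, posPart_add_negPart, Int.cast_abs]
  rw [e3, add_mul]
  linarith

/-- The difference analogue of the lemma on the logarithmic derivative. -/
theorem Meromorphic.exists_proximity_shift_div_le {F : ℂ → ℂ} (hF : Meromorphic F)
    (hF0 : ∀ z, meromorphicOrderAt F z ≠ ⊤) (η : ℂ) {δ : ℝ} (h0 : 0 < δ) (h1 : δ < 1) :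
    ∃ C : ℝ, 0 ≤ C ∧ ∀ r : ℝ, 1 ≤ r → ‖η‖ ≤ r →
      proximity (fun z ↦ F (z + η) / F z) ⊤ r ≤
        C * r ^ (-δ) * (characteristic F ⊤ (4 * r) + characteristic F ⊤ (8 * r) + 1) := by
  obtain ⟨C₀, hC₀, hinv⟩ := exists_characteristic_inv_le hF
  obtain ⟨C₁, hC₁, havg⟩ := exists_circleAverage_norm_sub_rpow_neg_le h0.le h1
  have hl2 : 0 < Real.log 2 := Real.log_pos one_lt_two
  set K : ℝ := ‖η‖ ^ δ / δ with hK
  have hK0 : 0 ≤ K := by positivity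
  refine ⟨2 * ‖η‖ * (2 + C₀) + K * (2 * C₁ + 2) * ((2 + C₀) / Real.log 2), by positivity,
    fun r hr hηr ↦ ?_⟩
  have hr0 : 0 < r := by linarith
  have hS := divisor_ball_support_finite (hF.meromorphicOn (s := closedBall 0 (4 * r)))
  set S := hS.toFinset with hSdef
  have hSS : (divisor F (ball 0 (4 * r))).support = S := by simp [S]
  have hSball : ∀ a ∈ S, a ∈ ball (0 : ℂ) (4 * r) := fun a ha ↦
    (divisor F (ball 0 (4 * r))).supportWithinDomain (by rw [hSS]; exact ha)
  set d : ℂ → ℝ := fun a ↦ |(divisor F (ball 0 (4 * r)) a : ℝ)| with hd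
  set A : ℝ := 2 * ‖η‖ / r * Real.circleAverage (fun z ↦ |Real.log ‖F z‖|) 0 (4 * r) with hA
  set G : ℂ → ℝ := fun z ↦ Real.posLog ‖F (z + η) / F z‖ with hG
  -- The pointwise majorant of `G`; the distance from `z + η` to `a` is rewritten as the distance
  -- from `z` to `a - η`, so the uniform circle average applies.
  set U : ℂ → ℝ := fun z ↦ A + ∑ a ∈ S, (d a * K) * (‖z - a‖ ^ (-δ) +
    (‖z - (a - η)‖ ^ (-δ) + 2 * r ^ (-δ))) with hU
  have hGU : ∀ᶠ z in codiscreteWithin (sphere (0 : ℂ) |r|), G z ≤ U z := by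
    have hg := hF.eventually_codiscrete_analyticAt_ne_zero hF0
    filter_upwards [hg.filter_mono (codiscreteWithin_mono (Set.subset_univ _)),
      (eventually_codiscrete_comp_add_right η hg).filter_mono
        (codiscreteWithin_mono (Set.subset_univ _)), self_mem_codiscreteWithin _]
      with z hz hzη hzs
    rw [abs_of_pos hr0, mem_sphere_zero_iff_norm] at hzs
    have hb := hF.abs_log_norm_sub_log_norm_le hF0 h0 h1.le hr0 (w := z) (w' := z + η)
      (by linarith) (by linarith [norm_add_le z η]) hz.1 hz.2 hzη.1 hzη.2 hSS
    rw [add_sub_cancel_left] at hb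
    calc G z ≤ |Real.log ‖F (z + η) / F z‖| := by
          rw [hG]; simp only [← Real.half_mul_log_add_log_abs]
          linarith [le_abs_self (Real.log ‖F (z + η) / F z‖)]
      _ = |Real.log ‖F (z + η)‖ - Real.log ‖F z‖| := by
          rw [norm_div, Real.log_div (norm_ne_zero_iff.2 hzη.2) (norm_ne_zero_iff.2 hz.2)]
      _ ≤ _ := hb
      _ = U z := by
          simp only [hU, hA, add_right_inj]
          refine Finset.sum_congr rfl fun a _ ↦ ?_
          rw [show z + η - a = z - (a - η) by ring]
          simp only [hd, hK]
          ring
  have hi (a : ℂ) := circleIntegrable_norm_sub_rpow_neg h0.le h1 a hr0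
  have hc (c : ℝ) : CircleIntegrable (fun _ ↦ c) 0 r := circleIntegrable_const c 0 r
  have hterm (a : ℂ) : CircleIntegrable (fun z ↦ ‖z - a‖ ^ (-δ) +
      (‖z - (a - η)‖ ^ (-δ) + 2 * r ^ (-δ))) 0 r := (hi a).add ((hi (a - η)).add (hc _))
  have hterm' (a : ℂ) : CircleIntegrable (fun z ↦ (d a * K) * (‖z - a‖ ^ (-δ) +
      (‖z - (a - η)‖ ^ (-δ) + 2 * r ^ (-δ)))) 0 r := (hterm a).const_smul (a := d a * K)
  have hsumint : CircleIntegrable (fun z ↦ ∑ a ∈ S, (d a * K) * (‖z - a‖ ^ (-δ) +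
      (‖z - (a - η)‖ ^ (-δ) + 2 * r ^ (-δ)))) 0 r :=
    CircleIntegrable.fun_sum S fun a _ ↦ hterm' a
  have hUint : CircleIntegrable U 0 r := (hc A).add hsumint
  have hGint : CircleIntegrable G 0 r := by
    have hmer : Meromorphic (fun z ↦ F (z + η) / F z) := by
      have : Meromorphic (fun z ↦ F (z + η)) := fun z ↦
        (hF (z + η)).comp_analyticAt (g := (· + η)) (by fun_prop)
      exact this.div hF
    exact MeromorphicOn.circleIntegrable_posLog_norm hmer.meromorphicOn
  -- `G ≤ U` is known only off a discrete set, while monotonicity of the average needs it everywhere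
  -- on the circle; `min G U` has the same average as `G`.
  have hmin : G =ᶠ[codiscreteWithin (sphere (0 : ℂ) |r|)] fun z ↦ min (G z) (U z) := by
    filter_upwards [hGU] with z hz
    rw [min_eq_left hz]
  have havgU : Real.circleAverage U 0 r ≤
      A + (∑ a ∈ S, d a) * (K * ((2 * C₁ + 2) * r ^ (-δ))) := by
    rw [hU, Real.circleAverage_fun_add (hc A) hsumint, Real.circleAverage_const,
      Real.circleAverage_fun_sum (fun a _ ↦ hterm' a), Finset.sum_mul]
    gcongr with a ha
    have e : Real.circleAverage (fun z ↦ (d a * K) * (‖z - a‖ ^ (-δ) +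
      (‖z - (a - η)‖ ^ (-δ) + 2 * r ^ (-δ)))) 0 r = (d a * K) *
        (Real.circleAverage (fun z ↦ ‖z - a‖ ^ (-δ)) 0 r +
        (Real.circleAverage (fun z ↦ ‖z - (a - η)‖ ^ (-δ)) 0 r + 2 * r ^ (-δ))) := by
      rw [show (fun z ↦ (d a * K) * (‖z - a‖ ^ (-δ) + (‖z - (a - η)‖ ^ (-δ) + 2 * r ^ (-δ)))) =
        fun z ↦ (d a * K) • (‖z - a‖ ^ (-δ) + (‖z - (a - η)‖ ^ (-δ) + 2 * r ^ (-δ))) from rfl,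
        Real.circleAverage_fun_smul,
        Real.circleAverage_fun_add (f₂ := fun z ↦ ‖z - (a - η)‖ ^ (-δ) + 2 * r ^ (-δ)) (hi _)
          ((hi _).add (hc _)),
        Real.circleAverage_fun_add (hi _) (hc _), Real.circleAverage_const, smul_eq_mul]
    rw [e, mul_assoc]
    have := havg a r hr0
    have := havg (a - η) r hr0
    have hda : 0 ≤ d a := abs_nonneg _
    gcongr
    linarith
  have hm : proximity (fun z ↦ F (z + η) / F z) ⊤ r ≤ Real.circleAverage U 0 r := by
    rw [proximity_top, Real.circleAverage_congr_codiscreteWithin hmin hr0.ne']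
    exact Real.circleAverage_mono (hGint.congr_codiscreteWithin hmin) hUint
      fun z _ ↦ min_le_right _ _
  set T4 := characteristic F ⊤ (4 * r)
  set T8 := characteristic F ⊤ (8 * r)
  have hT4 : 0 ≤ T4 := characteristic_nonneg (by linarith)
  have hT8 : 0 ≤ T8 := characteristic_nonneg (by linarith)
  have hA' : A ≤ 2 * ‖η‖ * r ^ (-δ) * ((2 + C₀) * (T4 + T8 + 1)) := by
    have hrδ : r⁻¹ ≤ r ^ (-δ) := by
      rw [← Real.rpow_neg_one]
      exact Real.rpow_le_rpow_of_exponent_le hr (by linarith)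
    have hB : Real.circleAverage (fun z ↦ |Real.log ‖F z‖|) 0 (4 * r) ≤
        (2 + C₀) * (T4 + T8 + 1) := by
      rw [circleAverage_abs_log_norm hF]
      have p1 := proximity_le_characteristic (f := F) (r := 4 * r) (by linarith)
      have p2 := proximity_le_characteristic (f := F⁻¹) (r := 4 * r) (by linarith)
      have p3 := hinv (4 * r)
      have : 0 ≤ C₀ * (T4 + T8) := by positivity
      nlinarith
    rw [hA, div_eq_mul_inv]
    gcongr
    rw [circleAverage_abs_log_norm hF]
    exact add_nonneg (proximity_nonneg _) (proximity_nonneg _)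
  have hn : ∑ a ∈ S, d a ≤ (2 + C₀) / Real.log 2 * (T4 + T8 + 1) := by
    have p1 := hF.sum_abs_divisor_mul_log_two_le (ρ := 4 * r) (by linarith) hSball
    have p3 := hinv (8 * r)
    rw [show 2 * (4 * r) = 8 * r by ring] at p1
    rw [div_mul_eq_mul_div, le_div_iff₀ hl2]
    have : 0 ≤ C₀ * (T4 + T8) := by positivity
    nlinarith
  calc _ ≤ _ := hm
    _ ≤ _ := havgU
    _ ≤ 2 * ‖η‖ * r ^ (-δ) * ((2 + C₀) * (T4 + T8 + 1)) +
      ((2 + C₀) / Real.log 2 * (T4 + T8 + 1)) * (K * ((2 * C₁ + 2) * r ^ (-δ))) := by gcongr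
    _ = _ := by ring

/-! ### Primary factors and canonical products -/

/-- The Weierstrass primary factor of genus `p`. -/
noncomputable def weierstrassFactor (p : ℕ) (u : ℂ) : ℂ :=
  (1 - u) * Complex.exp (∑ k ∈ Finset.range p, u ^ (k + 1) / (k + 1))

/-- The geometric sum telescopes against `1 - u`, leaving only `u ^ p`; hence the factor differs
from `1` by `O(u ^ (p + 1))`. -/
theorem hasDerivAt_weierstrassFactor (p : ℕ) (u : ℂ) :
    HasDerivAt (weierstrassFactor p)
      (-u ^ p * Complex.exp (∑ k ∈ Finset.range p, u ^ (k + 1) / (k + 1))) u := by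
  have h1 : HasDerivAt (fun u : ℂ ↦ ∑ k ∈ Finset.range p, u ^ (k + 1) / (k + 1))
      (∑ k ∈ Finset.range p, u ^ k) u := by
    refine HasDerivAt.fun_sum fun k _ ↦ ?_
    have := (hasDerivAt_pow (k + 1) u).div_const ((k : ℂ) + 1)
    have hk : ((k : ℂ) + 1) ≠ 0 := by exact_mod_cast k.succ_ne_zero
    simpa [mul_div_assoc, mul_comm, hk] using this
  have h2 := ((hasDerivAt_id u).const_sub 1).mul h1.cexp
  refine (h2.congr_deriv ?_)
  have hg := mul_neg_geom_sum u p
  simp only [id_eq]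
  linear_combination Complex.exp (∑ k ∈ Finset.range p, u ^ (k + 1) / (k + 1)) * hg

theorem differentiable_weierstrassFactor (p : ℕ) : Differentiable ℂ (weierstrassFactor p) :=
  fun u ↦ (hasDerivAt_weierstrassFactor p u).differentiableAt

theorem norm_sum_pow_div_le (p : ℕ) {u : ℂ} {B : ℝ} (hB : ∀ k < p, ‖u‖ ^ (k + 1) ≤ B) :
    ‖∑ k ∈ Finset.range p, u ^ (k + 1) / ((k : ℂ) + 1)‖ ≤ p * B := by
  refine (norm_sum_le _ _).trans ?_
  have : ∀ k ∈ Finset.range p, ‖u ^ (k + 1) / ((k : ℂ) + 1)‖ ≤ B := fun k hk ↦ by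
    rw [norm_div, norm_pow]
    have h1 : ‖((k : ℂ) + 1)‖ = k + 1 := by
      exact_mod_cast Complex.norm_natCast (k + 1)
    rw [h1]
    refine (div_le_self (by positivity) ?_).trans (hB k (Finset.mem_range.1 hk))
    linarith [Nat.cast_nonneg (α := ℝ) k]
  simpa using Finset.sum_le_card_nsmul _ _ _ this

theorem norm_weierstrassFactor_sub_one_le (p : ℕ) {u : ℂ} (hu : ‖u‖ ≤ 1) :
    ‖weierstrassFactor p u - 1‖ ≤ Real.exp p * ‖u‖ ^ (p + 1) := by
  have h1 : ∀ w ∈ closedBall (0 : ℂ) ‖u‖,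
      ‖-w ^ p * Complex.exp (∑ k ∈ Finset.range p, w ^ (k + 1) / ((k : ℂ) + 1))‖ ≤
        Real.exp p * ‖u‖ ^ p := by
    intro w hw
    rw [mem_closedBall_zero_iff] at hw
    rw [norm_mul, norm_neg, norm_pow, mul_comm]
    gcongr
    refine (Complex.norm_exp_le_exp_norm _).trans (Real.exp_le_exp.2 ?_)
    simpa using norm_sum_pow_div_le p (B := 1) fun k _ ↦
      pow_le_one₀ (norm_nonneg w) (hw.trans hu)
  have h2 := (convex_closedBall (0 : ℂ) ‖u‖).norm_image_sub_le_of_norm_hasDerivWithin_le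
    (fun w _ ↦ (hasDerivAt_weierstrassFactor p w).hasDerivWithinAt) h1
    (mem_closedBall_self (norm_nonneg u)) (y := u) (by simp)
  have h3 : weierstrassFactor p 0 = 1 := by simp [weierstrassFactor]
  rw [h3, sub_zero, mul_assoc, ← pow_succ] at h2
  exact h2

/-- For `‖u‖ ≤ 1` the vanishing of order `p + 1 ≥ s` suffices; for `‖u‖ ≥ 1` every power in the
exponent is at most `‖u‖ ^ p ≤ ‖u‖ ^ s`. One exponent `s` for both regimes lets the bounds be
multiplied. -/
theorem norm_weierstrassFactor_le {p : ℕ} (hp : 1 ≤ p) {s : ℝ} (h1 : p ≤ s) (h2 : s ≤ p + 1)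
    (u : ℂ) : ‖weierstrassFactor p u‖ ≤ Real.exp (Real.exp (p + 1) * ‖u‖ ^ s) := by
  have hp' : (1 : ℝ) ≤ p := by exact_mod_cast hp
  rcases le_total ‖u‖ 1 with hu | hu
  · calc ‖weierstrassFactor p u‖ = ‖1 + (weierstrassFactor p u - 1)‖ := by ring_nf
      _ ≤ 1 + Real.exp p * ‖u‖ ^ (p + 1) := by
        refine (norm_add_le _ _).trans ?_
        rw [norm_one]
        gcongr
        exact norm_weierstrassFactor_sub_one_le p hu
      _ ≤ 1 + Real.exp (p + 1) * ‖u‖ ^ s := by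
        gcongr
        · linarith
        · have : ‖u‖ ^ (p + 1) = ‖u‖ ^ ((p : ℝ) + 1) := by
            rw [← Real.rpow_natCast]; norm_cast
          rw [this]
          rcases (norm_nonneg u).eq_or_lt with h0 | h0
          · rw [← h0, Real.zero_rpow (by linarith), Real.zero_rpow (by linarith)]
          · exact Real.rpow_le_rpow_of_exponent_ge h0 hu h2
      _ ≤ _ := by linarith [Real.add_one_le_exp (Real.exp (p + 1) * ‖u‖ ^ s)]
  · have hus : ‖u‖ ^ p ≤ ‖u‖ ^ s := by
      rw [← Real.rpow_natCast]; exact Real.rpow_le_rpow_of_exponent_le hu h1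
    have hb (k : ℕ) (hk : k < p) : ‖u‖ ^ (k + 1) ≤ ‖u‖ ^ s :=
      (pow_le_pow_right₀ hu hk).trans hus
    have e1 : ‖1 - u‖ ≤ Real.exp (‖u‖ ^ s) := by
      have := hb 0 hp
      rw [zero_add, pow_one] at this
      have h3 := norm_sub_le 1 u
      rw [norm_one] at h3
      linarith [Real.add_one_le_exp (‖u‖ ^ s)]
    have e2 : ‖Complex.exp (∑ k ∈ Finset.range p, u ^ (k + 1) / ((k : ℂ) + 1))‖ ≤
        Real.exp (p * ‖u‖ ^ s) :=
      (Complex.norm_exp_le_exp_norm _).trans (Real.exp_le_exp.2 (norm_sum_pow_div_le p hb))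
    rw [weierstrassFactor, norm_mul]
    calc _ ≤ Real.exp (‖u‖ ^ s) * Real.exp (p * ‖u‖ ^ s) := by gcongr
      _ = Real.exp ((p + 1) * ‖u‖ ^ s) := by rw [← Real.exp_add]; ring_nf
      _ ≤ _ := by
        gcongr
        linarith [Real.add_one_le_exp ((p : ℝ) + 1)]

theorem weierstrassFactor_eq_zero_iff {p : ℕ} {u : ℂ} : weierstrassFactor p u = 0 ↔ u = 1 := by
  rw [weierstrassFactor, mul_eq_zero, or_iff_left (Complex.exp_ne_zero _), sub_eq_zero, eq_comm]

theorem differentiable_weierstrassFactor_div (p : ℕ) (b : ℂ) :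
    Differentiable ℂ (fun z ↦ weierstrassFactor p (z / b)) :=
  (differentiable_weierstrassFactor p).comp (differentiable_id.div_const b)

theorem analyticOrderAt_weierstrassFactor_div (p : ℕ) {b : ℂ} (hb : b ≠ 0) :
    analyticOrderAt (fun z ↦ weierstrassFactor p (z / b)) b = 1 := by
  have hd : HasDerivAt (fun z ↦ weierstrassFactor p (z / b)) _ b :=
    HasDerivAt.comp (h := fun z ↦ z / b) b (hasDerivAt_weierstrassFactor p (b / b))
      ((hasDerivAt_id b).div_const b)
  refine AnalyticAt.analyticOrderAt_eq_one_of_zero_deriv_ne_zero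
    ((differentiable_weierstrassFactor_div p b).analyticAt b) ?_ ?_
  · rw [weierstrassFactor_eq_zero_iff, div_self hb]
  · rw [hd.deriv]
    simp [hb, Complex.exp_ne_zero]

/-- The canonical product of genus `p` with zeros at the points `b k`. -/
noncomputable def canonicalProduct {κ : Type*} (p : ℕ) (b : κ → ℂ) (z : ℂ) : ℂ :=
  ∏' k, weierstrassFactor p (z / b k)

section canonicalProduct

theorem eventually_cofinite_lt_norm {κ : Type*} {b : κ → ℂ} (hb : ∀ k, b k ≠ 0) {s : ℝ}
    (hs : 0 < s) (hsum : Summable fun k ↦ ‖b k‖ ^ (-s)) (ρ : ℝ) :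
    ∀ᶠ k in cofinite, ρ < ‖b k‖ := by
  have hρ : 0 < max ρ 1 := by positivity
  filter_upwards [hsum.tendsto_cofinite_zero.eventually_lt_const
    (show 0 < (max ρ 1) ^ (-s) by positivity)] with k hk
  rw [Real.rpow_lt_rpow_iff_of_neg (norm_pos_iff.2 (hb k)) hρ (by linarith)] at hk
  exact (le_max_left _ _).trans_lt hk

theorem finite_setOf_eq {κ : Type*} {b : κ → ℂ} (hb : ∀ k, b k ≠ 0) {s : ℝ}
    (hs : 0 < s) (hsum : Summable fun k ↦ ‖b k‖ ^ (-s)) (z : ℂ) : {k | b k = z}.Finite := by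
  have h := eventually_cofinite_lt_norm hb hs hsum ‖z‖
  rw [eventually_cofinite] at h
  exact h.subset fun k hk ↦ by simp [Set.mem_ofPred.1 hk]

theorem eventually_cofinite_norm_weierstrassFactor_sub_one_le {κ : Type*} {p : ℕ} {b : κ → ℂ}
    (hb : ∀ k, b k ≠ 0) (hsum : Summable fun k ↦ ‖b k‖ ^ (-((p : ℝ) + 1))) (ρ : ℝ) :
    ∀ᶠ k in cofinite, ∀ z ∈ ball (0 : ℂ) ρ, ‖weierstrassFactor p (z / b k) - 1‖ ≤
      Real.exp p * ρ ^ (p + 1) * ‖b k‖ ^ (-((p : ℝ) + 1)) := by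
  filter_upwards [eventually_cofinite_lt_norm hb (by positivity) hsum ρ] with k hk z hz
  rw [mem_ball_zero_iff] at hz
  have hbk := norm_pos_iff.2 (hb k)
  refine (norm_weierstrassFactor_sub_one_le p ?_).trans ?_
  · rw [norm_div, div_le_one hbk]; linarith
  · rw [norm_div, div_pow, mul_assoc, Real.rpow_neg hbk.le, div_eq_mul_inv]
    have : ‖b k‖ ^ ((p : ℝ) + 1) = ‖b k‖ ^ (p + 1) := by
      rw [← Real.rpow_natCast]; norm_cast
    rw [this]
    gcongr

theorem summable_norm_weierstrassFactor_sub_one {κ : Type*} {p : ℕ} {b : κ → ℂ}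
    (hb : ∀ k, b k ≠ 0) (hsum : Summable fun k ↦ ‖b k‖ ^ (-((p : ℝ) + 1))) (z : ℂ) :
    Summable fun k ↦ ‖weierstrassFactor p (z / b k) - 1‖ := by
  refine (hsum.mul_left (Real.exp p * (‖z‖ + 1) ^ (p + 1))).of_norm_bounded_eventually ?_
  filter_upwards [eventually_cofinite_norm_weierstrassFactor_sub_one_le hb hsum (‖z‖ + 1)]
    with k hk
  rw [norm_norm]
  exact hk z (by simp)

theorem multipliable_weierstrassFactor {κ : Type*} {p : ℕ} {b : κ → ℂ}
    (hb : ∀ k, b k ≠ 0) (hsum : Summable fun k ↦ ‖b k‖ ^ (-((p : ℝ) + 1))) (z : ℂ) :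
    Multipliable fun k ↦ weierstrassFactor p (z / b k) := by
  simpa using multipliable_one_add_of_summable (summable_norm_weierstrassFactor_sub_one hb hsum z)

theorem differentiable_canonicalProduct {κ : Type*} {p : ℕ} {b : κ → ℂ}
    (hb : ∀ k, b k ≠ 0) (hsum : Summable fun k ↦ ‖b k‖ ^ (-((p : ℝ) + 1))) :
    Differentiable ℂ (canonicalProduct p b) := by
  intro z
  have h := Summable.hasProdLocallyUniformlyOn_one_add (isOpen_ball (x := (0 : ℂ)) (ε := ‖z‖ + 1))
    (hsum.mul_left (Real.exp p * (‖z‖ + 1) ^ (p + 1)))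
    (eventually_cofinite_norm_weierstrassFactor_sub_one_le hb hsum (‖z‖ + 1))
    (fun k ↦ ((differentiable_weierstrassFactor_div p (b k)).continuous.sub
      continuous_const).continuousOn)
  simp only [add_sub_cancel] at h
  rw [hasProdLocallyUniformlyOn_iff_tendstoLocallyUniformlyOn] at h
  have h2 := h.differentiableOn (Eventually.of_forall fun S ↦ by
    refine DifferentiableOn.fun_finsetProd fun k _ ↦ ?_
    exact (differentiable_weierstrassFactor_div p (b k)).differentiableOn) isOpen_ball
  exact h2.differentiableAt (isOpen_ball.mem_nhds (by simp))

theorem norm_canonicalProduct_le {κ : Type*} {p : ℕ} (hp : 1 ≤ p) {b : κ → ℂ}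
    (hb : ∀ k, b k ≠ 0) (hsum : Summable fun k ↦ ‖b k‖ ^ (-((p : ℝ) + 1))) {s : ℝ}
    (h1 : p ≤ s) (h2 : s ≤ p + 1) (hs : Summable fun k ↦ ‖b k‖ ^ (-s)) (z : ℂ) :
    ‖canonicalProduct p b z‖ ≤
      Real.exp ((Real.exp (p + 1) * ∑' k, ‖b k‖ ^ (-s)) * ‖z‖ ^ s) := by
  have h := (multipliable_weierstrassFactor hb hsum z).hasProd.norm
  refine le_of_tendsto h (Eventually.of_forall fun S ↦ ?_)
  calc ∏ k ∈ S, ‖weierstrassFactor p (z / b k)‖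
      ≤ ∏ k ∈ S, Real.exp (Real.exp (p + 1) * ‖z‖ ^ s * ‖b k‖ ^ (-s)) := by
        refine Finset.prod_le_prod (fun _ _ ↦ norm_nonneg _) fun k _ ↦ ?_
        refine (norm_weierstrassFactor_le hp h1 h2 _).trans (le_of_eq ?_)
        rw [norm_div, Real.div_rpow (norm_nonneg _) (norm_nonneg _), Real.rpow_neg (norm_nonneg _),
          mul_assoc, div_eq_mul_inv]
    _ = Real.exp (Real.exp (p + 1) * ‖z‖ ^ s * ∑ k ∈ S, ‖b k‖ ^ (-s)) := by
        rw [← Real.exp_sum, Finset.mul_sum]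
    _ ≤ _ := by
        rw [mul_right_comm]
        gcongr
        exact hs.sum_le_tsum S fun _ _ ↦ by positivity

theorem canonicalProduct_ne_zero {κ : Type*} {p : ℕ} {b : κ → ℂ}
    (hb : ∀ k, b k ≠ 0) (hsum : Summable fun k ↦ ‖b k‖ ^ (-((p : ℝ) + 1))) {z : ℂ}
    (hz : ∀ k, b k ≠ z) : canonicalProduct p b z ≠ 0 := by
  have := tprod_one_add_ne_zero_of_summable
    (f := fun k ↦ weierstrassFactor p (z / b k) - 1) (fun k ↦ ?_)
    (summable_norm_weierstrassFactor_sub_one hb hsum z)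
  · simpa [canonicalProduct] using this
  · rw [add_sub_cancel, ne_eq, weierstrassFactor_eq_zero_iff, div_eq_one_iff_eq (hb k)]
    exact (hz k).symm

/-- The finitely many factors with `b k = z` each have a simple zero at `z`, and the product of the
others does not vanish there. -/
theorem analyticOrderAt_canonicalProduct {κ : Type*} {p : ℕ} {b : κ → ℂ}
    (hb : ∀ k, b k ≠ 0) (hsum : Summable fun k ↦ ‖b k‖ ^ (-((p : ℝ) + 1))) (z : ℂ) :
    analyticOrderAt (canonicalProduct p b) z = Set.encard {k | b k = z} := by
  set S : Set κ := {k | b k = z} with hS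
  have hSfin : S.Finite := finite_setOf_eq hb (by positivity) hsum z
  have hbc : ∀ k : (Sᶜ : Set κ), b k ≠ 0 := fun k ↦ hb k
  have hsumc : Summable fun k : (Sᶜ : Set κ) ↦ ‖b k‖ ^ (-((p : ℝ) + 1)) :=
    hsum.subtype Sᶜ
  have hfac : canonicalProduct p b = (fun w ↦ weierstrassFactor p (w / z)) ^ S.ncard *
      canonicalProduct p (fun k : (Sᶜ : Set κ) ↦ b k) := by
    ext w
    have : Fintype S := hSfin.fintype
    have h1 := hasProd_fintype ((fun k ↦ weierstrassFactor p (w / b k)) ∘ ((↑) : S → κ))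
    have h2 := (multipliable_weierstrassFactor hbc hsumc w).hasProd
    have h3 := (HasProd.mul_compl (f := fun k ↦ weierstrassFactor p (w / b k)) h1 h2).tprod_eq
    rw [canonicalProduct, h3]
    simp only [Pi.mul_apply, Pi.pow_apply, canonicalProduct]
    congr 1
    rw [Finset.prod_congr rfl (g := fun _ ↦ weierstrassFactor p (w / z))
      (fun k _ ↦ by rw [Function.comp_apply, show b k = z from k.2])]
    rw [Finset.prod_const, Finset.card_univ, ← Nat.card_eq_fintype_card, Nat.card_coe_set_eq]
  have hA := (differentiable_weierstrassFactor_div p z).analyticAt z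
  have hB := (differentiable_canonicalProduct hbc hsumc).analyticAt z
  have hB0 : analyticOrderAt (canonicalProduct p (fun k : (Sᶜ : Set κ) ↦ b k)) z = 0 := by
    rw [hB.analyticOrderAt_eq_zero]
    exact canonicalProduct_ne_zero hbc hsumc fun k ↦ k.2
  rw [hfac, analyticOrderAt_mul (hA.pow _) hB, hB0, add_zero, analyticOrderAt_pow hA,
    ← hSfin.cast_ncard_eq]
  -- Without such an index `z` may be `0`, where `w / z` is a default value; the exponent is then
  -- zero, so it plays no role.
  rcases S.eq_empty_or_nonempty with h | ⟨k, hk⟩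
  · simp [h]
  · have hz : z ≠ 0 := by rw [← show b k = z from hk]; exact hb k
    rw [analyticOrderAt_weierstrassFactor_div p hz]
    simp

end canonicalProduct

/-! ### Zero-free entire functions of finite order -/

/-- Take for `g` a primitive of `W' / W` with the right value at `0`; then `W * exp (-g)` has
derivative zero. -/
theorem exists_eq_exp_of_differentiable {W : ℂ → ℂ} (hW : Differentiable ℂ W) (h0 : ∀ z, W z ≠ 0) :
    ∃ g : ℂ → ℂ, Differentiable ℂ g ∧ ∀ z, W z = Complex.exp (g z) := by
  have hd : Differentiable ℂ (fun z ↦ deriv W z / W z) :=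
    fun z ↦ ((hW.analyticAt z).deriv.differentiableAt).fun_div (hW z) (h0 z)
  obtain ⟨g, hg0, hg⟩ := hd.isExactOn_univ.with_val_at 0 (Complex.log (W 0))
  have hg' (z : ℂ) : HasDerivAt g (deriv W z / W z) z := hg z (Set.mem_univ z)
  have hgd : Differentiable ℂ g := fun z ↦ (hg' z).differentiableAt
  refine ⟨g, hgd, fun z ↦ ?_⟩
  have hk (z : ℂ) : HasDerivAt (fun z ↦ W z * Complex.exp (-g z)) 0 z := by
    refine ((hW z).hasDerivAt.mul (hg' z).neg.cexp).congr_deriv ?_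
    field_simp [h0 z]
    ring
  have hconst := is_const_of_deriv_eq_zero (fun z ↦ (hk z).differentiableAt)
    (fun z ↦ (hk z).deriv) z 0
  rw [hg0, Complex.exp_neg, Complex.exp_neg, Complex.exp_log (h0 0),
    mul_inv_cancel₀ (h0 0)] at hconst
  exact (eq_of_div_eq_one (by rwa [div_eq_mul_inv]))

/-- Poisson's formula for `Re g = log ‖exp g‖` on the circle of radius `2r`, where the kernel at `w`
lies between `0` and `3`. -/
theorem re_le_three_mul_proximity_exp {g : ℂ → ℂ} (hg : Differentiable ℂ g) {r : ℝ} (hr : 0 < r)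
    {w : ℂ} (hw : ‖w‖ < r) :
    (g w).re ≤ 3 * proximity (fun z ↦ Complex.exp (g z)) ⊤ (2 * r) := by
  have hR : 0 < 2 * r := by positivity
  have hwB : w ∈ ball (0 : ℂ) (2 * r) := by rw [mem_ball_zero_iff]; linarith
  have hE : Differentiable ℂ (fun z ↦ Complex.exp (g z)) := hg.cexp
  have h1 := InnerProductSpace.HarmonicOnNhd.circleAverage_re_herglotzRieszKernel_smul
    (f := fun z ↦ Real.log ‖Complex.exp (g z)‖) (c := 0) (R := 2 * r)
    (fun z _ ↦ (hE.analyticAt z).harmonicAt_log_norm (Complex.exp_ne_zero _)) hwB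
  simp only [Complex.norm_exp, Real.log_exp] at h1
  rw [← h1, proximity_top, ← smul_eq_mul (3 : ℝ), ← Real.circleAverage_fun_smul]
  have hmer : MeromorphicOn (fun z ↦ Complex.exp (g z)) (sphere 0 |2 * r|) :=
    fun z _ ↦ (hE.analyticAt z).meromorphicAt
  refine Real.circleAverage_mono ?_ ?_ ?_
  · refine circleIntegrable_re_herglotzRieszKernel_smul ?_ hwB
    exact (Complex.continuous_re.comp hg.continuous).continuousOn.circleIntegrable'
  · exact (MeromorphicOn.circleIntegrable_posLog_norm hmer).const_smul
  · intro ζ hζ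
    rw [abs_of_pos hR] at hζ
    have k1 := re_herglotzRieszKernel_le hζ hwB
    have k2 := le_re_herglotzRieszKernel hζ hwB
    simp only [Pi.smul_apply', Function.comp_apply, smul_eq_mul, herglotzRieszKernel_def,
      Complex.norm_exp]
    simp only [sub_zero] at k1 k2 ⊢
    have k3 : (2 * r + ‖w‖) / (2 * r - ‖w‖) ≤ 3 := by
      rw [div_le_iff₀ (by linarith)]; linarith
    have k4 : 0 ≤ (2 * r - ‖w‖) / (2 * r + ‖w‖) := div_nonneg (by linarith) (by positivity)
    have k5 : (g ζ).re ≤ Real.posLog (Real.exp (g ζ).re) := by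
      rw [Real.posLog]; simp
    have k6 := Real.posLog_nonneg (x := Real.exp (g ζ).re)
    calc _ ≤ ((ζ + w) / (ζ - w)).re * Real.posLog (Real.exp (g ζ).re) := by
          gcongr; linarith
      _ ≤ _ := by gcongr; linarith

/-- The proximity function bounds `Re g` from above, Borel-Carathéodory turns this into a bound for
`‖g‖` on the circle of radius `r / 2`, and Cauchy's estimate tends to zero because `s < n`. -/
theorem iteratedDeriv_eq_zero_of_proximity_exp_le {g : ℂ → ℂ} (hg : Differentiable ℂ g) {C s : ℝ}
    (h : ∀ᶠ r : ℝ in atTop, proximity (fun z ↦ Complex.exp (g z)) ⊤ r ≤ C * r ^ s) {n : ℕ}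
    (hn : s < n) (hn0 : n ≠ 0) : iteratedDeriv n g 0 = 0 := by
  have key : ∀ᶠ r : ℝ in atTop, ‖iteratedDeriv n g 0‖ ≤
      n.factorial * (2 * (3 * (|C| * (2 * r) ^ s) + 1) + 3 * ‖g 0‖) / (r / 2) ^ n := by
    have h2 : Tendsto (fun r : ℝ ↦ 2 * r) atTop atTop :=
      tendsto_id.const_mul_atTop (by norm_num)
    filter_upwards [h2.eventually h, eventually_gt_atTop 0] with r hr hr0
    -- The summand `1` keeps `M` positive even if `C = 0`, as Borel-Carathéodory requires.
    set M : ℝ := 3 * (|C| * (2 * r) ^ s) + 1 with hM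
    have hM0 : 0 < M := by positivity
    have hgM : Set.MapsTo g (ball 0 r) {z | z.re ≤ M} := by
      intro w hw
      have h3 := re_le_three_mul_proximity_exp hg hr0 (mem_ball_zero_iff.1 hw)
      have h4 : C * (2 * r) ^ s ≤ |C| * (2 * r) ^ s := by gcongr; exact le_abs_self C
      simp only [Set.mem_ofPred_eq]
      linarith
    refine Complex.norm_iteratedDeriv_le_of_forall_mem_sphere_norm_le n (by positivity)
      hg.diffContOnCl fun z hz ↦ ?_
    rw [mem_sphere_zero_iff_norm] at hz
    have h5 := Complex.borelCaratheodory hM0 hg.differentiableOn hgM hr0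
      (z := z) (by rw [mem_ball_zero_iff]; linarith)
    rw [hz] at h5
    refine h5.trans (le_of_eq ?_)
    field_simp
    ring
  have hlim : Tendsto (fun r : ℝ ↦ n.factorial * (2 * (3 * (|C| * (2 * r) ^ s) + 1) + 3 * ‖g 0‖) /
      (r / 2) ^ n) atTop (𝓝 0) := by
    have e1 : Tendsto (fun r : ℝ ↦ r ^ s / r ^ n) atTop (𝓝 0) := by
      have := tendsto_rpow_neg_atTop (show 0 < n - s by linarith)
      refine this.congr' ?_
      filter_upwards [eventually_gt_atTop 0] with r hr
      rw [neg_sub, Real.rpow_sub hr, Real.rpow_natCast]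
    have e2 : Tendsto (fun r : ℝ ↦ 1 / r ^ n) atTop (𝓝 0) :=
      tendsto_const_nhds.div_atTop (tendsto_pow_atTop hn0)
    have e3 := (e1.const_mul (n.factorial * 6 * |C| * 2 ^ s * 2 ^ n)).add
      (e2.const_mul (n.factorial * (2 + 3 * ‖g 0‖) * 2 ^ n))
    simp only [mul_zero, add_zero] at e3
    refine e3.congr' ?_
    filter_upwards [eventually_gt_atTop 0] with r hr
    rw [Real.mul_rpow (by norm_num) hr.le, div_pow]
    field_simp
    ring
  exact norm_le_zero_iff.1 (ge_of_tendsto hlim key)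

theorem exists_polynomial_of_proximity_exp_le {g : ℂ → ℂ} (hg : Differentiable ℂ g) {σ : ℝ}
    (hσ : 0 ≤ σ) (h : ∀ s > σ, ∃ C : ℝ, ∀ᶠ r : ℝ in atTop,
      proximity (fun z ↦ Complex.exp (g z)) ⊤ r ≤ C * r ^ s) :
    ∃ P : Polynomial ℂ, (P.natDegree : ℝ) ≤ σ ∧ ∀ z, g z = P.eval z := by
  have hz : ∀ n : ℕ, n ∉ Finset.range (⌊σ⌋₊ + 1) → iteratedDeriv n g 0 = 0 := by
    intro n hn
    rw [Finset.mem_range, not_lt, Nat.succ_le_iff, Nat.floor_lt hσ] at hn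
    obtain ⟨C, hC⟩ := h ((σ + n) / 2) (by linarith)
    refine iteratedDeriv_eq_zero_of_proximity_exp_le hg hC (by linarith) ?_
    rintro rfl
    simp only [Nat.cast_zero] at hn
    linarith
  refine ⟨∑ n ∈ Finset.range (⌊σ⌋₊ + 1),
    Polynomial.C ((n.factorial : ℂ)⁻¹ * iteratedDeriv n g 0) * Polynomial.X ^ n, ?_, fun z ↦ ?_⟩
  · refine le_trans ?_ (Nat.floor_le hσ)
    rw [Nat.cast_le]
    refine Polynomial.natDegree_sum_le_of_forall_le _ _ fun n hn ↦ ?_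
    exact (Polynomial.natDegree_C_mul_X_pow_le _ _).trans
      (Nat.lt_succ_iff.1 (Finset.mem_range.1 hn))
  · rw [← Complex.taylorSeries_eq_of_entire' 0 z hg, tsum_eq_sum
      (s := Finset.range (⌊σ⌋₊ + 1)) (fun n hn ↦ by rw [hz n hn]; ring)]
    simp [Polynomial.eval_finsetSum]

/-! ### The polynomial difference equation -/

theorem Polynomial.exists_eval_add_sub_eval_eq {η : ℂ} (hη : η ≠ 0) (d : ℕ) :
    ∀ P : Polynomial ℂ, P.natDegree < d → ∃ H : Polynomial ℂ, H.natDegree ≤ d ∧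
      ∀ z, H.eval (z + η) - H.eval z = P.eval z := by
  induction d with
  | zero => intro P hP; simp at hP
  | succ d ih =>
    intro P hP
    -- Chosen so that `c * ((z + η) ^ (d + 1) - z ^ (d + 1))` has the same coefficient of `z ^ d` as
    -- `P`; the remainder `Q` has smaller degree, or is zero when `d = 0`.
    set c : ℂ := P.coeff d / ((d + 1) * η) with hc
    have hd1 : ((d : ℂ) + 1) ≠ 0 := by exact_mod_cast d.succ_ne_zero
    set Q : Polynomial ℂ := P - Polynomial.C c *
      ((Polynomial.X + Polynomial.C η) ^ (d + 1) - Polynomial.X ^ (d + 1)) with hQ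
    have hcoeff : ∀ k, d ≤ k → Q.coeff k = 0 := by
      intro k hk
      simp only [hQ, Polynomial.coeff_sub, Polynomial.coeff_C_mul, Polynomial.coeff_X_add_C_pow,
        Polynomial.coeff_X_pow]
      rcases hk.eq_or_lt with rfl | hk
      · simp [hc]; field_simp; ring
      · rw [Polynomial.coeff_eq_zero_of_natDegree_lt (by omega)]
        rcases (Nat.succ_le_of_lt hk).eq_or_lt with h | h
        · rw [← h]; simp
        · rw [Nat.choose_eq_zero_of_lt h, if_neg (by omega)]; simp
    obtain ⟨H, hH, hHe⟩ : ∃ H : Polynomial ℂ, H.natDegree ≤ d ∧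
        ∀ z, H.eval (z + η) - H.eval z = Q.eval z := by
      rcases Nat.eq_zero_or_pos d with rfl | hd
      · have : Q = 0 := Polynomial.ext fun k ↦ by simp [hcoeff k (Nat.zero_le k)]
        exact ⟨0, by simp, by simp [this]⟩
      · refine ih Q ?_
        have : Q.natDegree ≤ d - 1 :=
          Polynomial.natDegree_le_iff_coeff_eq_zero.2 fun k hk ↦ hcoeff k (by omega)
        omega
    refine ⟨H + Polynomial.C c * Polynomial.X ^ (d + 1), ?_, fun z ↦ ?_⟩
    · refine (Polynomial.natDegree_add_le _ _).trans (max_le (by omega) ?_)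
      exact Polynomial.natDegree_C_mul_X_pow_le _ _
    · have := hHe z
      simp only [hQ, Polynomial.eval_add, Polynomial.eval_mul, Polynomial.eval_C,
        Polynomial.eval_pow, Polynomial.eval_X, Polynomial.eval_sub] at this ⊢
      linear_combination this

theorem Polynomial.exists_norm_eval_le (P : Polynomial ℂ) :
    ∃ C : ℝ, 0 ≤ C ∧ ∀ z : ℂ, 1 ≤ ‖z‖ → ‖P.eval z‖ ≤ C * ‖z‖ ^ P.natDegree := by
  refine ⟨∑ i ∈ Finset.range (P.natDegree + 1), ‖P.coeff i‖, by positivity, fun z hz ↦ ?_⟩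
  rw [Polynomial.eval_eq_sum_range, Finset.sum_mul]
  refine (norm_sum_le _ _).trans (Finset.sum_le_sum fun i hi ↦ ?_)
  rw [norm_mul, norm_pow]
  gcongr
  exact Nat.lt_succ_iff.1 (Finset.mem_range.1 hi)

/-! ### Zeros of an entire function and their exponent of convergence -/

theorem Differentiable.analyticOrderAt_ne_top {f : ℂ → ℂ} (hf : Differentiable ℂ f) (hf0 : f ≠ 0)
    (z : ℂ) : analyticOrderAt f z ≠ ⊤ := by
  rw [Ne, analyticOrderAt_eq_top]
  intro h
  exact hf0 (AnalyticOnNhd.eq_of_eventuallyEq (fun w _ ↦ hf.analyticAt w)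
    (fun w _ ↦ analyticAt_const) h)

/-- In the dyadic shell `2 ^ m ≤ ν i < 2 ^ (m + 1)` there are at most `K * 2 ^ ((m + 1) * s)`
indices, each contributing at most `2 ^ (-m * α)`; these bounds form a convergent geometric series.
-/
theorem summable_rpow_neg_of_card_le {ι : Type*} {ν : ι → ℝ} (hν : ∀ i, 1 ≤ ν i) {K s α : ℝ}
    (hα : 0 ≤ α) (hsα : s < α)
    (h : ∀ ρ : ℝ, 1 ≤ ρ → ∀ S : Finset ι, (∀ i ∈ S, ν i ≤ ρ) → (S.card : ℝ) ≤ K * ρ ^ s) :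
    Summable fun i ↦ ν i ^ (-α) := by
  classical
  choose n hn1 hn2 using fun i ↦ exists_nat_pow_near (hν i) (one_lt_two (α := ℝ))
  have hgeo : Summable fun m : ℕ ↦ K * 2 ^ s * ((2 : ℝ) ^ (s - α)) ^ m :=
    (summable_geometric_of_lt_one (by positivity)
      (Real.rpow_lt_one_of_one_lt_of_neg one_lt_two (by linarith))).mul_left _
  have hK : 0 ≤ K := by simpa using h 1 le_rfl ∅ (by simp)
  refine summable_of_sum_le (c := ∑' m : ℕ, K * 2 ^ s * ((2 : ℝ) ^ (s - α)) ^ m)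
    (fun i ↦ Real.rpow_nonneg (zero_le_one.trans (hν i)) _) fun S ↦ ?_
  rw [← Finset.sum_fiberwise_of_maps_to (t := S.image n)
    (fun i hi ↦ Finset.mem_image_of_mem n hi)]
  refine le_trans (Finset.sum_le_sum fun m _ ↦ ?_)
    (hgeo.sum_le_tsum (S.image n) fun m _ ↦ by positivity)
  have hcard := h (2 ^ (m + 1)) (one_le_pow₀ one_le_two) {i ∈ S | n i = m} (by
    intro i hi
    rw [← (Finset.mem_filter.1 hi).2]
    exact (hn2 i).le)
  have hterm : ∀ i ∈ ({i ∈ S | n i = m} : Finset ι), ν i ^ (-α) ≤ ((2 : ℝ) ^ m) ^ (-α) := by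
    intro i hi
    rw [← (Finset.mem_filter.1 hi).2]
    exact Real.rpow_le_rpow_of_nonpos (by positivity) (hn1 i) (by linarith)
  refine (Finset.sum_le_card_nsmul _ _ _ hterm).trans ?_
  rw [nsmul_eq_mul]
  calc _ ≤ K * (2 ^ (m + 1)) ^ s * ((2 : ℝ) ^ m) ^ (-α) := by gcongr
    _ = _ := by
      simp only [← Real.rpow_natCast, ← Real.rpow_mul (zero_le_two (α := ℝ)), mul_assoc,
        ← Real.rpow_add (zero_lt_two (α := ℝ))]
      congr 2
      push_cast
      ring

/-- The zeros of an analytic function, each repeated according to its multiplicity. -/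
def ZeroIndex (f : ℂ → ℂ) : Type := {q : ℂ × ℕ // (q.2 : ℕ∞) < analyticOrderAt f q.1}

/-- The point at which the indexed zero lies. -/
def ZeroIndex.point {f : ℂ → ℂ} (i : ZeroIndex f) : ℂ := i.1.1

theorem ZeroIndex.encard_setOf_point_eq {f : ℂ → ℂ} {z : ℂ} (hf : analyticOrderAt f z ≠ ⊤) :
    Set.encard {i : ZeroIndex f | i.point = z} = analyticOrderAt f z := by
  obtain ⟨n, hn⟩ := ENat.ne_top_iff_exists.1 hf
  have h : Set.BijOn (fun i : ZeroIndex f ↦ i.1.2) {i | i.point = z} (Finset.range n : Set ℕ) := by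
    refine ⟨fun i hi ↦ ?_, fun i hi j hj hij ↦ ?_, fun k hk ↦ ?_⟩
    · have h1 := i.2
      have h2 : i.1.1 = z := hi
      rw [h2, ← hn, Nat.cast_lt] at h1
      simpa using h1
    · exact Subtype.ext (Prod.ext (Eq.trans hi (Eq.symm hj)) hij)
    · refine ⟨⟨(z, k), ?_⟩, rfl, rfl⟩
      rw [← hn, Nat.cast_lt]
      simpa using hk
  rw [← h.injOn.encard_image, h.image_eq, Set.encard_coe_eq_coe_finsetCard, Finset.card_range, hn]

theorem ZeroIndex.card_mul_log_two_le {f : ℂ → ℂ} (hf : Differentiable ℂ f) (hf0 : f ≠ 0)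
    {ρ : ℝ} (hρ : 1 ≤ ρ) (S : Finset (ZeroIndex f)) (hS : ∀ i ∈ S, ‖i.point‖ ≤ ρ) :
    S.card * Real.log 2 ≤ logCounting f 0 (2 * ρ) := by
  classical
  have hm : MeromorphicOn f Set.univ := fun z _ ↦ (hf.analyticAt z).meromorphicAt
  have h1 := sum_mul_log_two_le_logCounting (D := (divisor f Set.univ)⁺) (posPart_nonneg _) hρ
    (S.image ZeroIndex.point) (by
      intro a ha
      obtain ⟨i, hi, rfl⟩ := Finset.mem_image.1 ha
      exact hS i hi)
  rw [logCounting_zero]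
  refine le_trans ?_ h1
  refine mul_le_mul_of_nonneg_right ?_ (Real.log_nonneg one_le_two)
  rw [Finset.card_eq_sum_card_image ZeroIndex.point S]
  push_cast
  refine Finset.sum_le_sum fun a _ ↦ ?_
  have hfin := hf.analyticOrderAt_ne_top hf0 a
  obtain ⟨n, hn⟩ := ENat.ne_top_iff_exists.1 hfin
  have h2 : (({i ∈ S | i.point = a} : Finset (ZeroIndex f)).card : ℕ∞) ≤ n := by
    rw [hn, ← ZeroIndex.encard_setOf_point_eq hfin, ← Set.encard_coe_eq_coe_finsetCard]
    exact Set.encard_le_encard fun i hi ↦ (Finset.mem_filter.1 (Finset.mem_coe.1 hi)).2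
  have h3 : divisor f Set.univ a = n := by
    rw [divisor_apply hm (Set.mem_univ a), (hf.analyticAt a).meromorphicOrderAt_eq, ← hn]
    rfl
  have h4 : (n : ℤ) ≤ (divisor f Set.univ)⁺ a := by
    rw [Function.locallyFinsuppWithin.posPart_apply, h3]
    exact le_posPart _
  have h5 : ({i ∈ S | i.point = a} : Finset (ZeroIndex f)).card ≤ n := by exact_mod_cast h2
  calc ((({i ∈ S | i.point = a} : Finset (ZeroIndex f)).card : ℕ) : ℝ) ≤ n := by exact_mod_cast h5
    _ ≤ _ := by exact_mod_cast h4

/-- The zeros of an entire function of order less than `α` have convergence exponent less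
than `α`. -/
theorem ZeroIndex.summable_rpow_neg {f : ℂ → ℂ} (hf : Differentiable ℂ f) (hf0 : f ≠ 0) {α : ℝ}
    (h : growthOrder f < (α : EReal)) :
    Summable fun i : ZeroIndex f ↦ (1 + ‖i.point‖) ^ (-α) := by
  obtain ⟨s, hs1, hs2⟩ := EReal.lt_iff_exists_real_btwn.1 h
  have hs0 : 0 ≤ s := EReal.coe_nonneg.1 ((growthOrder_nonneg f).trans hs1.le)
  rw [EReal.coe_lt_coe_iff] at hs2
  have hm : Meromorphic f := fun z ↦ (hf.analyticAt z).meromorphicAt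
  obtain ⟨C, hC0, hC⟩ := exists_characteristic_inv_le hm
  obtain ⟨R, hR⟩ := eventually_atTop.1 (eventually_characteristic_le_rpow hs1)
  -- The growth bound holds only from `R` on. Counting in the disk of radius `R' * ρ` makes it
  -- available for every `ρ ≥ 1`, at the cost of a constant.
  set R' := max R 1 with hR'
  have hl2 : 0 < Real.log 2 := Real.log_pos one_lt_two
  have hR1 : 1 ≤ R' := le_max_right _ _
  refine summable_rpow_neg_of_card_le (ν := fun i : ZeroIndex f ↦ 1 + ‖i.point‖)
    (K := ((2 * R') ^ s + C) / Real.log 2) (by simp) (hs0.trans hs2.le) hs2 fun ρ hρ S hS ↦ ?_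
  have hRρ1 : R' ≤ R' * ρ := le_mul_of_one_le_right (by positivity) hρ
  have hRρ2 : ρ ≤ R' * ρ := le_mul_of_one_le_left (by positivity) hR1
  have h1 := ZeroIndex.card_mul_log_two_le hf hf0 (ρ := R' * ρ) (by linarith) S
    (fun i hi ↦ by linarith [hS i hi])
  have h2 : logCounting f 0 (2 * (R' * ρ)) ≤ characteristic f ⊤ (2 * (R' * ρ)) + C := by
    rw [← logCounting_inv]
    exact logCounting_le_characteristic.trans (hC _)
  have h3 := hR (2 * (R' * ρ)) (by linarith [le_max_left R 1])
  have h4 : 1 ≤ ρ ^ s := Real.one_le_rpow hρ hs0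
  rw [div_mul_eq_mul_div, le_div_iff₀ hl2]
  calc _ ≤ (2 * (R' * ρ)) ^ s + C := by linarith
    _ = (2 * R') ^ s * ρ ^ s + C := by
      rw [← mul_assoc, Real.mul_rpow (by positivity) (by positivity)]
    _ ≤ _ := by nlinarith

/-! ### Entire functions with zeros along progressions -/

/-- The points `x i, x i + e, x i + 2 e, …`. -/
def progression {ι : Type*} (x : ι → ℂ) (e : ℂ) (q : ι × ℕ) : ℂ := x q.1 + q.2 * e

/-- A term equal to `z + e` is either the successor of a term equal to `z` or a starting point. At
the level of zeros this is the difference equation. -/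
theorem encard_progression_add {ι : Type*} (x : ι → ℂ) (e z : ℂ) :
    Set.encard {q | progression x e q = z + e} =
      Set.encard {q | progression x e q = z} + Set.encard {i | x i = z + e} := by
  have h1 : {q | progression x e q = z + e} =
      (fun q : ι × ℕ ↦ (q.1, q.2 + 1)) '' {q | progression x e q = z} ∪
        (fun i ↦ (i, 0)) '' {i | x i = z + e} := by
    ext ⟨i, k⟩
    cases k with
    | zero => simp [progression]
    | succ k => simp [progression, add_mul, ← add_assoc]
  have hd : Disjoint ((fun q : ι × ℕ ↦ (q.1, q.2 + 1)) '' {q | progression x e q = z})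
      ((fun i ↦ (i, 0)) '' {i | x i = z + e}) := by
    rw [Set.disjoint_left]
    rintro _ ⟨q, _, rfl⟩ ⟨i, _, h⟩
    simp at h
  rw [h1, Set.encard_union_eq hd, Function.Injective.encard_image, Function.Injective.encard_image]
  · exact fun i j h ↦ (Prod.ext_iff.1 h).1
  · intro q q' h
    simp only [Prod.mk.injEq, add_left_inj] at h
    exact Prod.ext h.1 h.2

/-- With `w = x i / e`, the half-plane condition rules out cancellation in `w + k`: its modulus
dominates both `Re w + k` and `|Im w|`. -/
theorem le_mul_norm_progression {ι : Type*} {x : ι → ℂ} {e : ℂ} (he : e ≠ 0)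
    (hx : ∀ i, 1 / 2 ≤ (x i / e).re) (q : ι × ℕ) :
    1 + ‖x q.1‖ ≤ 4 * (1 + ‖e‖) / ‖e‖ * ‖progression x e q‖ ∧
      1 + (q.2 : ℝ) ≤ 4 * (1 + ‖e‖) / ‖e‖ * ‖progression x e q‖ := by
  obtain ⟨i, k⟩ := q
  have he' : 0 < ‖e‖ := norm_pos_iff.2 he
  set w : ℂ := x i / e with hw
  have hxi : x i = w * e := by rw [hw, div_mul_cancel₀ _ he]
  have hb : progression x e (i, k) = (w + k) * e := by simp only [progression, hxi]; ring
  have h1 := Complex.abs_re_le_norm (w + k)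
  have h2 := Complex.abs_im_le_norm (w + k)
  have h3 := Complex.norm_le_abs_re_add_abs_im w
  have hre := hx i
  rw [← hw] at hre
  simp only [Complex.add_re, Complex.natCast_re, Complex.add_im, Complex.natCast_im, add_zero]
    at h1 h2
  have hk : (0 : ℝ) ≤ k := k.cast_nonneg
  rw [abs_of_nonneg (by linarith)] at h1
  rw [abs_of_nonneg (by linarith : 0 ≤ w.re)] at h3
  have hE : 4 * (1 + ‖e‖) / ‖e‖ * ‖progression x e (i, k)‖ = 4 * (1 + ‖e‖) * ‖w + k‖ := by
    rw [hb, norm_mul]; field_simp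
  simp only [hE, hxi, norm_mul]
  constructor <;> nlinarith [norm_nonneg w]

theorem progression_ne_zero {ι : Type*} {x : ι → ℂ} {e : ℂ} (he : e ≠ 0)
    (hx : ∀ i, 1 / 2 ≤ (x i / e).re) (q : ι × ℕ) : progression x e q ≠ 0 := by
  intro h
  have := (le_mul_norm_progression he hx q).1
  rw [h, norm_zero, mul_zero] at this
  linarith [norm_nonneg (x q.1)]

/-- The norm dominates both `1 + ‖x i‖` and `1 + k`, so the power splits into a product: `α` goes to
the starting points, `β > 1` to the step index. -/
theorem summable_norm_progression_rpow_neg {ι : Type*} {x : ι → ℂ} {e : ℂ} (he : e ≠ 0)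
    (hx : ∀ i, 1 / 2 ≤ (x i / e).re) {α β : ℝ} (hα : 0 ≤ α) (hβ : 1 < β)
    (h : Summable fun i ↦ (1 + ‖x i‖) ^ (-α)) :
    Summable fun q ↦ ‖progression x e q‖ ^ (-(α + β)) := by
  have hN : Summable fun k : ℕ ↦ (1 + (k : ℝ)) ^ (-β) := by
    have := (summable_nat_add_iff 1).2 (Real.summable_nat_rpow.2 (show -β < -1 by linarith))
    refine this.congr fun k ↦ ?_
    push_cast
    rw [add_comm]
  have he' : 0 < ‖e‖ := norm_pos_iff.2 he
  set M : ℝ := 4 * (1 + ‖e‖) / ‖e‖ with hM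
  have hM0 : 0 < M := by positivity
  refine ((h.mul_of_nonneg hN (fun i ↦ by positivity) fun k ↦ by positivity).mul_left
    (M ^ (α + β))).of_nonneg_of_le (fun q ↦ by positivity) fun q ↦ ?_
  obtain ⟨h1, h2⟩ := le_mul_norm_progression he hx q
  have hb : 0 < ‖progression x e q‖ := norm_pos_iff.2 (progression_ne_zero he hx q)
  have h3 : (M * ‖progression x e q‖) ^ (-(α + β)) ≤
      (1 + ‖x q.1‖) ^ (-α) * (1 + (q.2 : ℝ)) ^ (-β) := by
    rw [neg_add, Real.rpow_add (by positivity)]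
    exact mul_le_mul (Real.rpow_le_rpow_of_nonpos (by positivity) h1 (by linarith))
      (Real.rpow_le_rpow_of_nonpos (by positivity) h2 (by linarith)) (by positivity)
      (by positivity)
  calc _ = M ^ (α + β) * (M * ‖progression x e q‖) ^ (-(α + β)) := by
        rw [Real.mul_rpow hM0.le hb.le, ← mul_assoc, ← Real.rpow_add hM0, add_neg_cancel,
          Real.rpow_zero, one_mul]
    _ ≤ _ := by gcongr

theorem summable_one_add_norm_add_rpow_neg {ι : Type*} {a : ι → ℂ} {α : ℝ} (hα : 0 ≤ α)
    (h : Summable fun i ↦ (1 + ‖a i‖) ^ (-α)) (c : ℂ) :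
    Summable fun i ↦ (1 + ‖a i + c‖) ^ (-α) := by
  refine (h.mul_left ((1 + ‖c‖) ^ α)).of_nonneg_of_le (fun i ↦ by positivity) fun i ↦ ?_
  have h1 : 1 + ‖a i‖ ≤ (1 + ‖c‖) * (1 + ‖a i + c‖) := by
    have : ‖a i‖ ≤ ‖a i + c‖ + ‖c‖ := norm_le_add_norm_add _ _
    nlinarith [norm_nonneg c, norm_nonneg (a i + c)]
  have h2 := Real.rpow_le_rpow_of_nonpos (by positivity) h1 (show -α ≤ 0 by linarith)
  rw [Real.mul_rpow (by positivity) (by positivity)] at h2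
  calc _ = (1 + ‖c‖) ^ α * ((1 + ‖c‖) ^ (-α) * (1 + ‖a i + c‖) ^ (-α)) := by
        rw [← mul_assoc, ← Real.rpow_add (by positivity), add_neg_cancel, Real.rpow_zero, one_mul]
    _ ≤ _ := by gcongr

/-- An entire function with prescribed simple zeros (with repetition) along arithmetic
progressions, of controlled growth. -/
theorem exists_differentiable_analyticOrderAt_eq_progression {ι : Type*} {x : ι → ℂ} {e : ℂ}
    (he : e ≠ 0) (hx : ∀ i, 1 / 2 ≤ (x i / e).re) {σ : ℝ} (hσ : 0 ≤ σ)
    (h : ∀ α > σ, Summable fun i ↦ (1 + ‖x i‖) ^ (-α)) :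
    ∃ P : ℂ → ℂ, Differentiable ℂ P ∧ P ≠ 0 ∧
      (∀ z, analyticOrderAt P z = Set.encard {q | progression x e q = z}) ∧
      ∀ s > σ + 1, ∃ C : ℝ, 0 ≤ C ∧ ∀ z, 1 ≤ ‖z‖ → ‖P z‖ ≤ Real.exp (C * ‖z‖ ^ s) := by
  -- Then `p ≤ σ + 1 < p + 1`, which leaves room for exponents strictly above `σ + 1` that still fit
  -- genus `p`.
  set p : ℕ := ⌊σ + 1⌋₊ with hp
  have hp1 : (p : ℝ) ≤ σ + 1 := Nat.floor_le (by linarith)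
  have hp2 : σ + 1 < p + 1 := Nat.lt_floor_add_one _
  have hp0 : 1 ≤ p := Nat.le_floor (by simpa using hσ)
  have hb := progression_ne_zero he hx
  have hs (s : ℝ) (hs : σ + 1 < s) : Summable fun q ↦ ‖progression x e q‖ ^ (-s) := by
    have := summable_norm_progression_rpow_neg he hx (α := (σ + s - 1) / 2)
      (β := (s + 1 - σ) / 2) (by linarith) (by linarith) (h _ (by linarith))
    convert this using 4
    ring
  have hsum := hs (p + 1) hp2
  refine ⟨canonicalProduct p (progression x e), differentiable_canonicalProduct hb hsum, ?_,
    analyticOrderAt_canonicalProduct hb hsum, fun s hs' ↦ ?_⟩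
  · intro h0
    have h1 := canonicalProduct_ne_zero hb hsum hb
    rw [h0] at h1
    exact h1 rfl
  -- The product estimate needs an exponent at most `p + 1`; for larger `s` it is weakened using
  -- `‖z‖ ≥ 1`.
  · have h1 : σ + 1 < min s (p + 1) := lt_min hs' hp2
    refine ⟨Real.exp (p + 1) * ∑' q, ‖progression x e q‖ ^ (-(min s (p + 1))),
      mul_nonneg (by positivity) (tsum_nonneg fun q ↦ by positivity), fun z hz ↦ ?_⟩
    refine (norm_canonicalProduct_le hp0 hb hsum (hp1.trans h1.le) (min_le_right _ _)
      (hs _ h1) z).trans ?_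
    have h2 : (0 : ℝ) ≤ ∑' q, ‖progression x e q‖ ^ (-(min s (p + 1))) :=
      tsum_nonneg fun q ↦ by positivity
    gcongr
    exact min_le_left _ _

/-- Entire functions `P₁`, `P₂` such that `P₁ (z + η) / P₂ (z + η)` and `Ψ z * P₁ z / P₂ z` have the
same zeros and poles. -/
theorem exists_quotient_with_divisor {η : ℂ} (hη : η ≠ 0) {σ : ℝ} {Ψ : ℂ → ℂ}
    (hΨ : Differentiable ℂ Ψ) (hΨ0 : Ψ ≠ 0) (hσ : growthOrder Ψ = (σ : EReal)) :
    ∃ P₁ P₂ : ℂ → ℂ, Differentiable ℂ P₁ ∧ Differentiable ℂ P₂ ∧ P₁ ≠ 0 ∧ P₂ ≠ 0 ∧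
      (∀ z, analyticOrderAt P₁ (z + η) + analyticOrderAt P₂ z =
        analyticOrderAt Ψ z + analyticOrderAt P₁ z + analyticOrderAt P₂ (z + η)) ∧
      ∀ s > σ + 1, ∃ C : ℝ, 0 ≤ C ∧ ∀ z, 1 ≤ ‖z‖ →
        ‖P₁ z‖ ≤ Real.exp (C * ‖z‖ ^ s) ∧ ‖P₂ z‖ ≤ Real.exp (C * ‖z‖ ^ s) := by
  have hσ0 : 0 ≤ σ := EReal.coe_nonneg.1 (hσ ▸ growthOrder_nonneg Ψ)
  have hsum (α : ℝ) (hα : σ < α) : Summable fun i : ZeroIndex Ψ ↦ (1 + ‖i.point‖) ^ (-α) :=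
    ZeroIndex.summable_rpow_neg hΨ hΨ0 (hσ ▸ EReal.coe_lt_coe_iff.2 hα)
  -- The cut at `-1/2` gives the starting points `a + η` with step `η`, and `a` with step `-η`, real
  -- part at least `1/2` after division by the step.
  set R : Set (ZeroIndex Ψ) := {i | -(1 / 2) ≤ (i.point / η).re} with hR
  obtain ⟨P₁, hP₁, hP₁0, hord₁, hgr₁⟩ := exists_differentiable_analyticOrderAt_eq_progression
    (x := fun i : R ↦ i.1.point + η) hη (fun i ↦ by
      have h1 : -(1 / 2) ≤ (i.1.point / η).re := i.2
      rw [add_div, div_self hη, Complex.add_re, Complex.one_re]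
      linarith) hσ0
    (fun α hα ↦ summable_one_add_norm_add_rpow_neg (hσ0.trans hα.le)
      ((hsum α hα).subtype R) η)
  obtain ⟨P₂, hP₂, hP₂0, hord₂, hgr₂⟩ := exists_differentiable_analyticOrderAt_eq_progression
    (x := fun i : (Rᶜ : Set (ZeroIndex Ψ)) ↦ i.1.point) (neg_ne_zero.2 hη) (fun i ↦ by
      have h1 : ¬ -(1 / 2) ≤ (i.1.point / η).re := i.2
      rw [div_neg, Complex.neg_re]
      linarith) hσ0
    (fun α hα ↦ (hsum α hα).subtype Rᶜ)
  refine ⟨P₁, P₂, hP₁, hP₂, hP₁0, hP₂0, fun z ↦ ?_, fun s hs ↦ ?_⟩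
  · have e1 := encard_progression_add (fun i : R ↦ i.1.point + η) η z
    have e2 := encard_progression_add (fun i : (Rᶜ : Set (ZeroIndex Ψ)) ↦ i.1.point) (-η) (z + η)
    rw [add_neg_cancel_right] at e2
    rw [hord₁, hord₁, hord₂, hord₂, e1, e2]
    have e3 : analyticOrderAt Ψ z = Set.encard {i : R | i.1.point + η = z + η} +
        Set.encard {i : (Rᶜ : Set (ZeroIndex Ψ)) | i.1.point = z} := by
      rw [← ZeroIndex.encard_setOf_point_eq (hΨ.analyticOrderAt_ne_top hΨ0 z),
        ← Subtype.val_injective.encard_image, ← Subtype.val_injective.encard_image,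
        ← Set.encard_union_eq]
      · congr 1
        ext i
        by_cases hi : i ∈ R <;> simp [hi]
      · rw [Set.disjoint_left]
        rintro _ ⟨i, _, rfl⟩ ⟨j, _, hj⟩
        exact j.2 (hj ▸ i.2)
    rw [e3]
    ring
  · obtain ⟨C₁, hC₁, h₁⟩ := hgr₁ s hs
    obtain ⟨C₂, hC₂, h₂⟩ := hgr₂ s hs
    refine ⟨max C₁ C₂, le_max_of_le_left hC₁, fun z hz ↦ ⟨(h₁ z hz).trans ?_, (h₂ z hz).trans ?_⟩⟩
    · gcongr; exact le_max_left _ _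
    · gcongr; exact le_max_right _ _

/-! ### The lower bound for the order of a solution -/

theorem Differentiable.meromorphic {f : ℂ → ℂ} (hf : Differentiable ℂ f) : Meromorphic f :=
  fun z ↦ (hf.analyticAt z).meromorphicAt

theorem Differentiable.meromorphicOrderAt_ne_top {f : ℂ → ℂ} (hf : Differentiable ℂ f)
    (hf0 : f ≠ 0) (z : ℂ) : meromorphicOrderAt f z ≠ ⊤ := by
  rw [(hf.analyticAt z).meromorphicOrderAt_eq, Ne, ENat.map_eq_top_iff]
  exact hf.analyticOrderAt_ne_top hf0 z

theorem MeromorphicNFOn.meromorphicOrderAt_ne_top {F : ℂ → ℂ} (hF : MeromorphicNFOn F Set.univ)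
    (hF0 : F ≠ 0) (z : ℂ) : meromorphicOrderAt F z ≠ ⊤ := by
  have hm : Meromorphic F := fun z ↦ (hF (Set.mem_univ z)).meromorphicAt
  refine hm.exists_meromorphicOrderAt_ne_top_iff_forall.1 ?_ z
  by_contra! h
  refine hF0 (funext fun x ↦ ?_)
  have h1 : F =ᶠ[𝓝[≠] x] 0 := meromorphicOrderAt_eq_top_iff.1 (h x)
  exact (((hF (Set.mem_univ x)).eventuallyEq_nhdsNE_iff_eventuallyEq_nhds
    analyticAt_const.meromorphicNFAt).1 h1).eq_of_nhds

theorem meromorphicOrderAt_mul_ne_top {f g : ℂ → ℂ} (hf : Meromorphic f)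
    (hf0 : ∀ z, meromorphicOrderAt f z ≠ ⊤) (hg : Meromorphic g)
    (hg0 : ∀ z, meromorphicOrderAt g z ≠ ⊤) (z : ℂ) : meromorphicOrderAt (f * g) z ≠ ⊤ := by
  rw [meromorphicOrderAt_mul (hf z) (hg z)]
  exact WithTop.add_ne_top.2 ⟨hf0 z, hg0 z⟩

theorem meromorphicOrderAt_inv_ne_top {f : ℂ → ℂ} (hf0 : ∀ z, meromorphicOrderAt f z ≠ ⊤) (z : ℂ) :
    meromorphicOrderAt f⁻¹ z ≠ ⊤ := by
  rw [meromorphicOrderAt_inv]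
  obtain ⟨n, hn⟩ := WithTop.ne_top_iff_exists.1 (hf0 z)
  rw [← hn]
  exact WithTop.coe_ne_top

theorem Meromorphic.exists_proximity_shift_div_le_rpow {F : ℂ → ℂ} (hF : Meromorphic F)
    (hF0 : ∀ z, meromorphicOrderAt F z ≠ ⊤) (η : ℂ) {δ ρ K : ℝ} (h0 : 0 < δ) (h1 : δ < 1)
    (hρ : 0 ≤ ρ) (h : ∀ᶠ r : ℝ in atTop, characteristic F ⊤ r ≤ K * r ^ ρ) :
    ∃ C : ℝ, 0 ≤ C ∧ ∀ᶠ r : ℝ in atTop,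
      proximity (fun z ↦ F (z + η) / F z) ⊤ r ≤ C * r ^ (ρ - δ) := by
  obtain ⟨C, hC0, hC⟩ := hF.exists_proximity_shift_div_le hF0 η h0 h1
  refine ⟨C * (|K| * 4 ^ ρ + |K| * 8 ^ ρ + 1), by positivity, ?_⟩
  have h4 : Tendsto (fun r : ℝ ↦ 4 * r) atTop atTop := tendsto_id.const_mul_atTop (by norm_num)
  have h8 : Tendsto (fun r : ℝ ↦ 8 * r) atTop atTop := tendsto_id.const_mul_atTop (by norm_num)
  filter_upwards [h4.eventually h, h8.eventually h, eventually_ge_atTop 1,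
    eventually_ge_atTop ‖η‖] with r h4 h8 hr hr'
  have hr0 : 0 < r := by linarith
  rw [Real.mul_rpow (by norm_num) hr0.le] at h4 h8
  have hr1 : 1 ≤ r ^ ρ := Real.one_le_rpow hr hρ
  have h4' : K * (4 ^ ρ * r ^ ρ) ≤ |K| * 4 ^ ρ * r ^ ρ := by
    rw [← mul_assoc]; gcongr; exact le_abs_self K
  have h8' : K * (8 ^ ρ * r ^ ρ) ≤ |K| * 8 ^ ρ * r ^ ρ := by
    rw [← mul_assoc]; gcongr; exact le_abs_self K
  calc _ ≤ C * r ^ (-δ) * (characteristic F ⊤ (4 * r) + characteristic F ⊤ (8 * r) + 1) :=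
        hC r hr hr'
    _ ≤ C * r ^ (-δ) * ((|K| * 4 ^ ρ + |K| * 8 ^ ρ + 1) * r ^ ρ) := by gcongr; linarith
    _ = _ := by
      rw [sub_eq_neg_add, Real.rpow_add hr0]
      ring

/-- `Ψ` is entire, so its characteristic is the proximity function of `F(z + η) / F(z)`, which the
difference lemma makes smaller than the growth of `F` by almost a full power of `r`. -/
theorem growthOrder_lt_of_shift {η : ℂ} {Ψ F : ℂ → ℂ} {σ : ℝ} (hσ : 0 < σ)
    (hΨ : Differentiable ℂ Ψ) (hF : Meromorphic F) (hF0 : ∀ z, meromorphicOrderAt F z ≠ ⊤)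
    (heq : ∀ᶠ z in codiscrete ℂ, F (z + η) = Ψ z * F z)
    (h : growthOrder F < ((σ + 1 : ℝ) : EReal)) : growthOrder Ψ < (σ : EReal) := by
  obtain ⟨ρ₀, hρ₀, hρ₀'⟩ := EReal.lt_iff_exists_real_btwn.1 h
  rw [EReal.coe_lt_coe_iff] at hρ₀'
  -- Raising `ρ` to at least `1` keeps `ρ - δ` nonnegative, as an order must be; it stays below `σ +
  -- 1` because `σ > 0`.
  set ρ := max ρ₀ 1 with hρ
  have hρ1 : 1 ≤ ρ := le_max_right _ _
  have hρσ : ρ < σ + 1 := max_lt hρ₀' (by linarith)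
  have hFρ : growthOrder F < (ρ : EReal) :=
    hρ₀.trans_le (EReal.coe_le_coe_iff.2 (le_max_left _ _))
  -- The first entry is the midpoint of `ρ - σ` and `1`, so `ρ - δ < σ` and `δ < 1`; the second
  -- keeps `δ` positive.
  set δ := max ((ρ - σ + 1) / 2) (1 / 2) with hδ
  have hδ1 : δ < 1 := max_lt (by linarith) (by norm_num)
  have hδ2 : (ρ - σ + 1) / 2 ≤ δ := le_max_left _ _
  have hδ3 : 1 / 2 ≤ δ := le_max_right _ _
  have hT : ∀ᶠ r : ℝ in atTop, characteristic F ⊤ r ≤ 1 * r ^ ρ := by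
    simpa using eventually_characteristic_le_rpow hFρ
  obtain ⟨C, hC0, hC⟩ := hF.exists_proximity_shift_div_le_rpow hF0 η (δ := δ) (by linarith) hδ1
    (by linarith) hT
  have hco : Ψ =ᶠ[codiscrete ℂ] fun z ↦ F (z + η) / F z := by
    filter_upwards [heq, hF.eventually_codiscrete_analyticAt_ne_zero hF0] with z hz hz0
    rw [hz, mul_div_cancel_right₀ _ hz0.2]
  refine (growthOrder_le_of_eventually_le (ρ := ρ - δ) (by linarith) fun s hs ↦ ⟨C, ?_⟩).trans_lt
    (EReal.coe_lt_coe_iff.2 (by linarith))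
  filter_upwards [hC, eventually_ge_atTop 1] with r hr hr1
  rw [characteristic_of_differentiable hΨ, proximity_congr_codiscrete hco (by linarith)]
  refine hr.trans ?_
  gcongr

/-! ### Construction of a solution of order at most `σ + 1` -/

theorem IsMeromorphicSolution.eventually_codiscrete {η : ℂ} {Ψ F : ℂ → ℂ}
    (hF : IsMeromorphicSolution η Ψ F) : ∀ᶠ z in codiscrete ℂ, F (z + η) = Ψ z * F z := by
  have h1 : ∀ᶠ z in codiscrete ℂ, AnalyticAt ℂ F z :=
    hF.meromorphic.meromorphicOn.analyticAt_mem_codiscreteWithin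
  filter_upwards [h1, eventually_codiscrete_comp_add_right η h1] with z hz hz'
  exact hF.equation z hz hz'

/-- Passing to normal form removes the removable singularities; where both sides are then
continuous, the identity off a discrete set extends to the point. -/
theorem isMeromorphicSolution_toMeromorphicNFOn {η : ℂ} {Ψ f : ℂ → ℂ} (hΨ : Differentiable ℂ Ψ)
    (hf : Meromorphic f) (heq : ∀ᶠ z in codiscrete ℂ, f (z + η) = Ψ z * f z) :
    IsMeromorphicSolution η Ψ (toMeromorphicNFOn f Set.univ) := by
  refine ⟨meromorphicNFOn_toMeromorphicNFOn _ _, fun z hz hz' ↦ ?_⟩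
  have h1 : ∀ᶠ z in codiscrete ℂ, f z = toMeromorphicNFOn f Set.univ z :=
    toMeromorphicNFOn_eqOn_codiscrete hf.meromorphicOn
  have h2 : ∀ᶠ w in codiscrete ℂ, toMeromorphicNFOn f Set.univ (w + η) =
      Ψ w * toMeromorphicNFOn f Set.univ w := by
    filter_upwards [h1, eventually_codiscrete_comp_add_right η h1, heq] with w h h' h''
    rw [← h, ← h', h'']
  have hc : ContinuousAt (fun w ↦ toMeromorphicNFOn f Set.univ (w + η)) z :=
    ContinuousAt.comp (f := fun w ↦ w + η) hz'.continuousAt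
      (continuous_add_const η).continuousAt
  exact ((hc.eventuallyEq_nhds_iff_eventuallyEq_nhdsNE
    (hΨ.continuous.continuousAt.mul hz.continuousAt)).1
      (eventually_codiscrete_iff.1 h2 z)).eq_of_nhds

theorem growthOrder_toMeromorphicNFOn {f : ℂ → ℂ} (hf : Meromorphic f) :
    growthOrder (toMeromorphicNFOn f Set.univ) = growthOrder f :=
  (growthOrder_congr_codiscrete (toMeromorphicNFOn_eqOn_codiscrete hf.meromorphicOn)).symm

theorem exists_characteristic_mul_inv_le {A B : ℂ → ℂ} (hA : Differentiable ℂ A) (hA0 : A ≠ 0)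
    (hB : Differentiable ℂ B) (hB0 : B ≠ 0) {C s : ℝ} (hC : 0 ≤ C) (hs : 0 ≤ s)
    (h : ∀ z, 1 ≤ ‖z‖ → ‖A z‖ ≤ Real.exp (C * ‖z‖ ^ s) ∧ ‖B z‖ ≤ Real.exp (C * ‖z‖ ^ s)) :
    ∃ K : ℝ, ∀ᶠ r : ℝ in atTop, characteristic (A * B⁻¹) ⊤ r ≤ K * r ^ s := by
  obtain ⟨C', hC'0, hC'⟩ := exists_characteristic_inv_le hB.meromorphic
  refine ⟨C + C + C', ?_⟩
  filter_upwards [eventually_ge_atTop 1] with r hr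
  have h0 : 0 ≤ C * r ^ s := by positivity
  have h1 := characteristic_mul_top_le hr hA.meromorphic (hA.meromorphicOrderAt_ne_top hA0)
    hB.meromorphic.inv (meromorphicOrderAt_inv_ne_top (hB.meromorphicOrderAt_ne_top hB0))
  have h2 := characteristic_le_of_norm_le_exp hA (r := r) (by linarith) h0 fun z hz ↦ by
    rw [← hz]; exact (h z (by linarith)).1
  have h3 := characteristic_le_of_norm_le_exp hB (r := r) (by linarith) h0 fun z hz ↦ by
    rw [← hz]; exact (h z (by linarith)).2
  have h4 : 1 ≤ r ^ s := Real.one_le_rpow hr hs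
  have h5 := hC' r
  rw [Pi.add_apply] at h1
  nlinarith

theorem exists_differentiable_exp_of_meromorphicOrderAt_eq_zero {Q : ℂ → ℂ} (hQ : Meromorphic Q)
    (h0 : ∀ z, meromorphicOrderAt Q z = 0) :
    ∃ g : ℂ → ℂ, Differentiable ℂ g ∧ ∀ᶠ z in codiscrete ℂ, Q z = Complex.exp (g z) := by
  have hNF : MeromorphicNFOn (toMeromorphicNFOn Q Set.univ) Set.univ :=
    meromorphicNFOn_toMeromorphicNFOn _ _
  have hord (z : ℂ) : meromorphicOrderAt (toMeromorphicNFOn Q Set.univ) z = 0 := by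
    rw [meromorphicOrderAt_toMeromorphicNFOn hQ.meromorphicOn (Set.mem_univ z), h0]
  obtain ⟨g, hg, hge⟩ := exists_eq_exp_of_differentiable (W := toMeromorphicNFOn Q Set.univ)
    (fun z ↦ ((hNF (Set.mem_univ z)).meromorphicOrderAt_nonneg_iff_analyticAt.1
      (hord z).ge).differentiableAt)
    (fun z ↦ (hNF (Set.mem_univ z)).meromorphicOrderAt_eq_zero_iff.1 (hord z))
  refine ⟨g, hg, ?_⟩
  have h1 : ∀ᶠ z in codiscrete ℂ, Q z = toMeromorphicNFOn Q Set.univ z :=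
    toMeromorphicNFOn_eqOn_codiscrete hQ.meromorphicOn
  filter_upwards [h1] with z hz
  rw [hz, hge]

/-- Entire functions of order at most `σ + 1` whose quotient solves the difference equation up to a
nonvanishing entire factor. -/
theorem exists_solution_up_to_exp {η : ℂ} (hη : η ≠ 0) {σ : ℝ} {Ψ : ℂ → ℂ}
    (hΨ : Differentiable ℂ Ψ) (hΨ0 : Ψ ≠ 0) (hσ : growthOrder Ψ = (σ : EReal)) :
    ∃ P₁ P₂ g : ℂ → ℂ, Differentiable ℂ P₁ ∧ Differentiable ℂ P₂ ∧ P₁ ≠ 0 ∧ P₂ ≠ 0 ∧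
      Differentiable ℂ g ∧
      (∀ s > σ + 1, ∃ C : ℝ, 0 ≤ C ∧ ∀ z, 1 ≤ ‖z‖ →
        ‖P₁ z‖ ≤ Real.exp (C * ‖z‖ ^ s) ∧ ‖P₂ z‖ ≤ Real.exp (C * ‖z‖ ^ s)) ∧
      ∀ᶠ z in codiscrete ℂ, (P₁ * P₂⁻¹) (z + η) / (P₁ * P₂⁻¹) z * (Ψ z)⁻¹ =
        Complex.exp (g z) := by
  obtain ⟨P₁, P₂, hP₁, hP₂, hP₁0, hP₂0, hord, hgr⟩ := exists_quotient_with_divisor hη hΨ hΨ0 hσ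
  have hs₁ : Differentiable ℂ (P₁ ∘ (· + η)) := hP₁.comp (differentiable_id.add_const η)
  have hs₂ : Differentiable ℂ (P₂ ∘ (· + η)) := hP₂.comp (differentiable_id.add_const η)
  have hQ : Meromorphic (P₁ ∘ (· + η) * P₂ * (Ψ * P₁ * P₂ ∘ (· + η))⁻¹) :=
    (hs₁.mul hP₂).meromorphic.mul ((hΨ.mul hP₁).mul hs₂).meromorphic.inv
  obtain ⟨g, hg, hge⟩ := exists_differentiable_exp_of_meromorphicOrderAt_eq_zero hQ (by
    intro z
    rw [meromorphicOrderAt_mul ((hs₁.mul hP₂).meromorphic z)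
      (((hΨ.mul hP₁).mul hs₂).meromorphic.inv z), meromorphicOrderAt_inv,
      meromorphicOrderAt_mul (hs₁.meromorphic z) (hP₂.meromorphic z),
      meromorphicOrderAt_mul ((hΨ.mul hP₁).meromorphic z) (hs₂.meromorphic z),
      meromorphicOrderAt_mul (hΨ.meromorphic z) (hP₁.meromorphic z),
      meromorphicOrderAt_comp_add_const_eq_meromorphicOrderAt,
      meromorphicOrderAt_comp_add_const_eq_meromorphicOrderAt]
    have h := hord z
    simp only [(hP₁.analyticAt _).meromorphicOrderAt_eq, (hP₂.analyticAt _).meromorphicOrderAt_eq,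
      (hΨ.analyticAt _).meromorphicOrderAt_eq]
    obtain ⟨a, ha⟩ := ENat.ne_top_iff_exists.1 (hP₁.analyticOrderAt_ne_top hP₁0 (z + η))
    obtain ⟨b, hb⟩ := ENat.ne_top_iff_exists.1 (hP₂.analyticOrderAt_ne_top hP₂0 z)
    obtain ⟨c, hc⟩ := ENat.ne_top_iff_exists.1 (hΨ.analyticOrderAt_ne_top hΨ0 z)
    obtain ⟨d, hd⟩ := ENat.ne_top_iff_exists.1 (hP₁.analyticOrderAt_ne_top hP₁0 z)
    obtain ⟨e, he⟩ := ENat.ne_top_iff_exists.1 (hP₂.analyticOrderAt_ne_top hP₂0 (z + η))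
    rw [← ha, ← hb, ← hc, ← hd, ← he] at h ⊢
    have h' : a + b = c + d + e := by exact_mod_cast h
    have h'' : ((a : ℤ) + b - (c + d + e) : ℤ) = 0 := by omega
    exact congrArg ((↑) : ℤ → WithTop ℤ) h'')
  refine ⟨P₁, P₂, g, hP₁, hP₂, hP₁0, hP₂0, hg, hgr, ?_⟩
  filter_upwards [hge] with z hz
  rw [← hz]
  simp only [Pi.mul_apply, Pi.inv_apply, Function.comp_apply, mul_inv, div_eq_mul_inv, inv_inv]
  ring

/-- `exp g` is the shift quotient of `f` times `Ψ⁻¹`: the difference lemma controls the first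
factor, and the characteristic of `Ψ⁻¹` is that of `Ψ` up to a constant. -/
theorem proximity_exp_le_of_shift {η : ℂ} {σ : ℝ} {Ψ f g : ℂ → ℂ} (hσ0 : 0 ≤ σ)
    (hΨ : Differentiable ℂ Ψ) (hσ : growthOrder Ψ = (σ : EReal)) (hf : Meromorphic f)
    (hf0 : ∀ z, meromorphicOrderAt f z ≠ ⊤)
    (hgr : ∀ s > σ + 1, ∃ K : ℝ, ∀ᶠ r : ℝ in atTop, characteristic f ⊤ r ≤ K * r ^ s)
    (heq : ∀ᶠ z in codiscrete ℂ, f (z + η) / f z * (Ψ z)⁻¹ = Complex.exp (g z)) {s : ℝ}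
    (hs : σ < s) : ∃ C : ℝ, ∀ᶠ r : ℝ in atTop,
      proximity (fun z ↦ Complex.exp (g z)) ⊤ r ≤ C * r ^ s := by
  -- With `δ = 1 - ε` the resulting exponent `(σ + 1 + ε) - δ = σ + 2ε` is at most `s`, and `δ`
  -- stays positive.
  set ε := min ((s - σ) / 2) (1 / 2) with hε
  have hε0 : 0 < ε := lt_min (by linarith) (by norm_num)
  have hε1 : ε ≤ (s - σ) / 2 := min_le_left _ _
  have hε2 : ε ≤ 1 / 2 := min_le_right _ _
  obtain ⟨K, hK⟩ := hgr (σ + 1 + ε) (by linarith)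
  obtain ⟨C, hC0, hC⟩ := hf.exists_proximity_shift_div_le_rpow hf0 η (δ := 1 - ε) (by linarith)
    (by linarith) (by linarith) hK
  obtain ⟨C', hC'0, hC'⟩ := exists_characteristic_inv_le hΨ.meromorphic
  have hT := eventually_characteristic_le_rpow (f := Ψ) (ρ := s)
    (hσ ▸ EReal.coe_lt_coe_iff.2 hs)
  refine ⟨C + 1 + C', ?_⟩
  have hshift : Meromorphic (fun z ↦ f (z + η) / f z) :=
    Meromorphic.div (f := fun z ↦ f (z + η)) (fun z ↦
      meromorphicAt_comp_add_const_iff_meromorphicAt.2 (hf (z + η))) hf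
  filter_upwards [hC, hT, eventually_ge_atTop 1] with r hr hTr hr1
  have hco : (fun z ↦ Complex.exp (g z)) =ᶠ[codiscrete ℂ]
      (fun z ↦ f (z + η) / f z) * Ψ⁻¹ := by
    filter_upwards [heq] with z hz
    exact hz.symm
  rw [proximity_congr_codiscrete hco (by linarith)]
  have h1 := proximity_mul_top_le hshift hΨ.meromorphic.inv r
  have h2 := proximity_le_characteristic (f := Ψ⁻¹) hr1
  have h3 := hC' r
  have h4 : 1 ≤ r ^ s := Real.one_le_rpow hr1 (by linarith)
  have h5 : r ^ (σ + 1 + ε - (1 - ε)) ≤ r ^ s := Real.rpow_le_rpow_of_exponent_le hr1 (by linarith)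
  rw [Pi.add_apply] at h1
  nlinarith

/-- A meromorphic solution of order at most `σ + 1`. -/
theorem exists_solution_growthOrder_le {η : ℂ} (hη : η ≠ 0) {σ : ℝ} {Ψ : ℂ → ℂ}
    (hΨ : Differentiable ℂ Ψ) (hΨ0 : Ψ ≠ 0) (hσ : growthOrder Ψ = (σ : EReal)) :
    ∃ f : ℂ → ℂ, Meromorphic f ∧ (∀ z, meromorphicOrderAt f z ≠ ⊤) ∧
      (∀ᶠ z in codiscrete ℂ, f (z + η) = Ψ z * f z) ∧
      growthOrder f ≤ ((σ + 1 : ℝ) : EReal) := by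
  have hσ0 : 0 ≤ σ := EReal.coe_nonneg.1 (hσ ▸ growthOrder_nonneg Ψ)
  obtain ⟨P₁, P₂, g, hP₁, hP₂, hP₁0, hP₂0, hg, hgr, heq⟩ := exists_solution_up_to_exp hη hΨ hΨ0 hσ
  have hinv := meromorphicOrderAt_inv_ne_top (hP₂.meromorphicOrderAt_ne_top hP₂0)
  have hmer : Meromorphic (P₁ * P₂⁻¹) := hP₁.meromorphic.mul hP₂.meromorphic.inv
  have hne := meromorphicOrderAt_mul_ne_top hP₁.meromorphic
    (hP₁.meromorphicOrderAt_ne_top hP₁0) hP₂.meromorphic.inv hinv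
  obtain ⟨P, hPdeg, hPg⟩ := exists_polynomial_of_proximity_exp_le hg hσ0 fun s hs ↦
    proximity_exp_le_of_shift hσ0 hΨ hσ hmer hne (fun s hs ↦ by
      obtain ⟨C, hC0, hC⟩ := hgr s hs
      exact exists_characteristic_mul_inv_le hP₁ hP₁0 hP₂ hP₂0 hC0 (by linarith) hC) heq hs
  -- The degree of `H` is at most `deg P + 1 ≤ σ + 1`, so the correction `exp(-H)` does not raise
  -- the order above `σ + 1`.
  obtain ⟨H, hHdeg, hH⟩ := Polynomial.exists_eval_add_sub_eval_eq hη (P.natDegree + 1) P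
    (Nat.lt_succ_self _)
  have hE : Differentiable ℂ (fun z ↦ Complex.exp (-H.eval z)) := H.differentiable.neg.cexp
  have hA : Differentiable ℂ ((fun z ↦ Complex.exp (-H.eval z)) * P₁) := hE.mul hP₁
  have hA0 : (fun z ↦ Complex.exp (-H.eval z)) * P₁ ≠ 0 := by
    intro h
    refine hP₁0 (funext fun z ↦ ?_)
    have := congrFun h z
    simpa [Complex.exp_ne_zero] using this
  refine ⟨(fun z ↦ Complex.exp (-H.eval z)) * P₁ * P₂⁻¹, hA.meromorphic.mul hP₂.meromorphic.inv,
    meromorphicOrderAt_mul_ne_top hA.meromorphic (hA.meromorphicOrderAt_ne_top hA0)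
      hP₂.meromorphic.inv hinv, ?_, ?_⟩
  · filter_upwards [heq, hmer.eventually_codiscrete_analyticAt_ne_zero hne,
      hΨ.meromorphic.eventually_codiscrete_analyticAt_ne_zero
        (hΨ.meromorphicOrderAt_ne_top hΨ0)] with z hz hz1 hz2
    rw [← div_eq_mul_inv, div_div, div_eq_iff (mul_ne_zero hz1.2 hz2.2)] at hz
    have h1 : Complex.exp (-H.eval (z + η)) * Complex.exp (g z) = Complex.exp (-H.eval z) := by
      rw [← Complex.exp_add, hPg, ← hH z]
      congr 1
      ring
    simp only [mul_assoc, Pi.mul_apply] at hz ⊢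
    rw [hz, ← h1]
    ring
  · obtain ⟨D, hD0, hD⟩ := H.exists_norm_eval_le
    refine growthOrder_le_of_eventually_le (by linarith) fun s hs ↦ ?_
    obtain ⟨C, hC0, hC⟩ := hgr s hs
    refine exists_characteristic_mul_inv_le hA hA0 hP₂ hP₂0 (C := D + C) (by positivity)
      (by linarith) fun z hz ↦ ⟨?_, (hC z hz).2.trans ?_⟩
    · have h1 : ‖H.eval z‖ ≤ D * ‖z‖ ^ s := by
        refine (hD z hz).trans ?_
        rw [← Real.rpow_natCast]
        have : (H.natDegree : ℝ) ≤ P.natDegree + 1 := by exact_mod_cast hHdeg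
        gcongr
        linarith
      have h2 : (-H.eval z).re ≤ ‖H.eval z‖ := by
        simpa using Complex.re_le_norm (-H.eval z)
      rw [Pi.mul_apply, norm_mul, Complex.norm_exp, add_mul, Real.exp_add]
      gcongr
      · exact h2.trans h1
      · exact (hC z hz).1
    · gcongr
      linarith

/-- If `f` has order less than one then `f * exp (c * z)` with `c ≠ 0` has order exactly one. -/
theorem growthOrder_mul_exp_of_lt_one {f : ℂ → ℂ} (hf : Meromorphic f)
    (hf0 : ∀ z, meromorphicOrderAt f z ≠ ⊤) (h : growthOrder f < ((1 : ℝ) : EReal)) {c : ℂ}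
    (hc : c ≠ 0) : growthOrder (f * fun z ↦ Complex.exp (c * z)) = ((1 : ℝ) : EReal) := by
  have hE : Differentiable ℂ (fun z ↦ Complex.exp (c * z)) := by fun_prop
  have hE0 : (fun z ↦ Complex.exp (c * z)) ≠ 0 := fun h ↦ by
    simpa using congrFun h 0
  have hEne := hE.meromorphicOrderAt_ne_top hE0
  refine le_antisymm ?_ ?_
  · refine growthOrder_le_of_eventually_le zero_le_one fun s hs ↦ ⟨1 + ‖c‖, ?_⟩
    filter_upwards [eventually_characteristic_le_rpow h, eventually_ge_atTop 1] with r hr hr1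
    have h1 := characteristic_mul_top_le hr1 hf hf0 hE.meromorphic hEne
    have h2 := characteristic_le_of_norm_le_exp hE (r := r) (B := ‖c‖ * r) (by linarith)
      (by positivity) fun z hz ↦ by
        rw [Complex.norm_exp, ← hz, ← norm_mul]
        exact Real.exp_le_exp.2 (Complex.re_le_norm _)
    have h3 : r ≤ r ^ s := Real.self_le_rpow_of_one_le hr1 hs.le
    rw [Real.rpow_one] at hr
    rw [Pi.add_apply] at h1
    nlinarith [norm_nonneg c]
  · by_contra! hlt
    obtain ⟨ρ, hρ, hρ1⟩ := EReal.lt_iff_exists_real_btwn.1 (max_lt h hlt)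
    rw [EReal.coe_lt_coe_iff] at hρ1
    have hρ0 : 0 ≤ ρ :=
      EReal.coe_nonneg.1 ((growthOrder_nonneg f).trans ((le_max_left _ _).trans hρ.le))
    have hm : Meromorphic (f * fun z ↦ Complex.exp (c * z)) := hf.mul hE.meromorphic
    have hne := meromorphicOrderAt_mul_ne_top hf hf0 hE.meromorphic hEne
    obtain ⟨C, hC0, hC⟩ := exists_characteristic_inv_le hf
    -- If the product also had order below one, so would `exp (c * z)`, its quotient by `f`; the
    -- linear coefficient `c` of the exponent would then vanish.
    have key : iteratedDeriv 1 (fun z ↦ c * z) 0 = 0 := by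
      refine iteratedDeriv_eq_zero_of_proximity_exp_le (C := 2 + C) (s := ρ) (by fun_prop) ?_
        (by simpa using hρ1) one_ne_zero
      filter_upwards [eventually_characteristic_le_rpow ((le_max_left _ _).trans_lt hρ),
        eventually_characteristic_le_rpow ((le_max_right _ _).trans_lt hρ),
        eventually_ge_atTop 1] with r h1 h2 hr1
      have hco : (fun z ↦ Complex.exp (c * z)) =ᶠ[codiscrete ℂ]
          (f * fun z ↦ Complex.exp (c * z)) * f⁻¹ := by
        filter_upwards [hf.eventually_codiscrete_analyticAt_ne_zero hf0] with z hz
        simp only [Pi.mul_apply, Pi.inv_apply]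
        field_simp [hz.2]
      rw [← characteristic_of_differentiable hE, characteristic_congr_codiscrete hco (by linarith)]
      have h3 := characteristic_mul_top_le hr1 hm hne hf.inv (meromorphicOrderAt_inv_ne_top hf0)
      have h4 := hC r
      have h5 : 1 ≤ r ^ ρ := Real.one_le_rpow hr1 hρ0
      rw [Pi.add_apply] at h3
      nlinarith
    have hd : HasDerivAt (fun z ↦ c * z) c 0 := by
      simpa using (hasDerivAt_id (0 : ℂ)).const_mul c
    rw [iteratedDeriv_one, hd.deriv] at key
    exact hc key

/-! ### The order `σ + 1` is attained and minimal -/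

theorem mainTheorem6 (η : ℂ) (hη : η ≠ 0) (σ : ℝ) (Ψ : ℂ → ℂ)
    (hΨ : Differentiable ℂ Ψ) (hΨ0 : Ψ ≠ 0) (hσ : growthOrder Ψ = (σ : EReal)) :
    (∃ F : ℂ → ℂ, IsMeromorphicSolution η Ψ F ∧ growthOrder F = ((σ + 1 : ℝ) : EReal)) ∧
    (0 < σ → ∀ F : ℂ → ℂ, IsMeromorphicSolution η Ψ F → F ≠ 0 →
      ((σ + 1 : ℝ) : EReal) ≤ growthOrder F) := by
  have hσ0 : 0 ≤ σ := EReal.coe_nonneg.1 (hσ ▸ growthOrder_nonneg Ψ)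
  constructor
  · obtain ⟨f, hf, hf0, heq, hle⟩ := exists_solution_growthOrder_le hη hΨ hΨ0 hσ
    rcases hle.eq_or_lt with h | h
    · exact ⟨_, isMeromorphicSolution_toMeromorphicNFOn hΨ hf heq, by
        rw [growthOrder_toMeromorphicNFOn hf, h]⟩
    -- For `σ = 0` the lower bound is not available, so the order is raised to one by the
    -- `η`-periodic factor `exp(2πiz / η)`; for `σ > 0` a smaller order is contradictory.
    rcases hσ0.eq_or_lt with rfl | hpos
    · rw [zero_add] at h ⊢
      have hc : 2 * Real.pi * Complex.I / η ≠ 0 := div_ne_zero Complex.two_pi_I_ne_zero hη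
      have hm : Meromorphic (f * fun z ↦ Complex.exp (2 * Real.pi * Complex.I / η * z)) :=
        hf.mul (Differentiable.meromorphic (by fun_prop))
      refine ⟨_, isMeromorphicSolution_toMeromorphicNFOn hΨ hm ?_, by
        rw [growthOrder_toMeromorphicNFOn hm, growthOrder_mul_exp_of_lt_one hf hf0 h hc]⟩
      filter_upwards [heq] with z hz
      rw [Pi.mul_apply, Pi.mul_apply, hz, mul_add, div_mul_cancel₀ _ hη,
        Complex.exp_add, Complex.exp_two_pi_mul_I]
      ring
    · exact absurd (growthOrder_lt_of_shift hpos hΨ hf hf0 heq h) (by simp [hσ])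
  · intro hpos F hF hF0
    by_contra! h
    exact absurd (growthOrder_lt_of_shift hpos hΨ (fun z ↦ (hF.meromorphic
      (Set.mem_univ z)).meromorphicAt) (hF.meromorphic.meromorphicOrderAt_ne_top hF0)
      hF.eventually_codiscrete h) (by simp [hσ])
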